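/- Let $\mathbb K$ be a perfect field and let $F\in\mathbb K[[x]][y]$ be a square-free Weierstrass polynomial of degree $d\ge 1$ (monic in $y$, all non-leading coefficients vanishing at $x=0$), where $\mathbb K$ has characteristic $0$ or greater than $d$. *Boundary polynomials.* Let $\mathrm{val}$ be the $x$-adic valuation (on a polynomial in $y$: the minimum over the coefficients). For $H=\sum_i a_i y^i=\sum_{i,j}a_{ij}x^jy^i\in\mathbb L[[x]][y]$ over a field $\mathbb L$, the Newton polygon $\mathcal N(H)$ is the lower convex hull of the points $(i,\mathrm{val}(a_i))$, $a_i\neq0$, and $\bar H=\sum_{(i,j)\in\mathcal N(H)}a_{ij}x^jy^i$ is the boundary polynomial. $H$ has edge data $(q,m,P,N)$ if $q>0$ and $m$ are coprime, $P\in\mathbb L[Z]$ is monic irreducible with $P\ne Z$, and $\bar H=c\,\big(P(y^q/x^m)\,x^{m\deg P}\big)^N$ with $c\in\mathbb L^\times$. *The sequence $H_0,\dots,H_g$.* For $G$ of degree $N$ put $c(G)=-\mathrm{coeff}(G,y^{N-1})/N$. Let $\mathbb K_0=\mathbb K$, $c_0=c(F)$, $H_0=F(x,y+c_0(x))$, and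 $\pi_0(x,y)=(x,y+c_0(x))$. If $H_{k-1}\in\mathbb K_{k-1}[[x]][y]$ has edge data $(q_k,m_k,P_k,N_k)$, let $\ell_k=\deg P_k$, $\mathbb K_k=\mathbb K_{k-1}[Z_k]/(P_k)$, let $z_k$ be the class of $Z_k$, and let $s_k,t_k$ be the integers with $q_ks_k-t_km_k=1$, $0\le t_k<q_k$. Then $$H_{k-1}\big(z_k^{t_k}x^{q_k},x^{m_k}(y+z_k^{s_k})\big)=x^{q_km_k\ell_kN_k}\,G_k\,V_k$$ with $V_k\in\mathbb K_k[[x,y]]$ a unit and $G_k\in\mathbb K_k[[x]][y]$ Weierstrass of degree $N_k$; put $c_k=c(G_k)$, $H_k=G_k(x,y+c_k(x))$ and $\pi_k=\pi_{k-1}\circ\sigma_k$, where $\sigma_k(x,y)=\big(z_k^{t_k}x^{q_k},x^{m_k}(y+z_k^{s_k}+c_k(x))\big)$. The sequence stops at the first $g$ for which $H_g$ has no edge data. Let $N_k=\deg H_k$. *Notation at rank $k$.* Fix $0\le k\le g$. For $0\le i\le k$ let $\phi_i\in\mathbb K[[x]][y]$ be the minimal polynomial of the parametrisation $\pi_i(x,0)$,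 that is the monic irreducible polynomial with $\phi_i(\pi_i(x,0))=0$; let $\phi_{-1}=x$ and $\Phi=(\phi_{-1},\phi_0,\dots,\phi_k)$. For $H\in\mathbb K[[x]][y]$, let $v_k(H)=\mathrm{val}(\pi_k^*H)$, and let $\lambda_k(H)\in\mathbb K_k$ be the trailing coefficient in $y$ of $(\pi_k^*H/x^{v_k(H)})_{|x=0}$ (with $\lambda_k(0)=0$). Put $V=(v_k(\phi_{-1}),\dots,v_k(\phi_k))$ and $\Lambda=(\lambda_k(\phi_{-1}),\dots,\lambda_k(\phi_k))$. Let $$\mathcal B=\{(b_{-1},\dots,b_k)\in\mathbb N^{k+2}:\ b_{i-1}<q_i\ell_i,\ 1\le i\le k\},\qquad \mathcal B(i,w)=\{B\in\mathcal B:\ b_k=i,\ \langle B,V\rangle=w\},$$ and let $B_0=(0,\dots,0,N_k)$. **Theorem.** $F$ has a unique $\Phi$-adic expansion $F=\sum_{B\in\mathcal B}f_B\Phi^B$ with $f_B\in\mathbb K$ (in which only finitely many $(b_0,\dots,b_k)$ occur), the valuation $v_k(F)$ is finite, the entries of $\Lambda$ are non-zero, and the sets $\mathcal B(i,w)$ are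 finite. Put $w_i=\min\{\langle B,V\rangle:\ b_k=i,\ f_B\neq0\}-v_k(F)\in\mathbb N\cup\{\infty\}$, with $w_i=\infty$ if there is no such $B$; these are indeed non-negative. Then the boundary polynomial of $H_k$ is $$\bar H_k=\sum_{(i,w_i)\in\mathcal N(H_k)}\Big(\sum_{B\in\mathcal B(i,w_i+v_k(F))}f_B\,\Lambda^{B-B_0}\Big)x^{w_i}y^i,$$ where $0\le i\le N_k$ in the outer sum. -/

import Mathlib

open scoped Polynomial PowerSeries

universe u

noncomputable section

namespace NewtonPuiseux

/-! Throughout, `L⟦X⟧[X]` is the ring `L[[x]][y]`: the inner variable is `x`, the outer one `y`. -/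

section Boundary

variable {L : Type u} [Field L]

/-- Weierstrass polynomials in `L[[x]][y]`: monic in `y`, of positive degree, and all the
non-leading coefficients vanish at `x = 0`. -/
structure IsWeierstrass (F : L⟦X⟧[X]) : Prop where
  monic : F.Monic
  degree_pos : 0 < F.natDegree
  coeff_zero : ∀ i < F.natDegree, PowerSeries.constantCoeff (F.coeff i) = 0

/-- The lower convex hull of a set of points of the plane, as a polygonal line: the points of the
convex hull that have no point of the convex hull strictly below them. -/
def lowerHull (s : Set (ℝ × ℝ)) : Set (ℝ × ℝ) :=
  {p | p ∈ convexHull ℝ s ∧ ∀ p' ∈ convexHull ℝ s, p'.1 = p.1 → p.2 ≤ p'.2}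

/-- The Newton polygon of `F = ∑ aᵢ(x) yⁱ`: the lower convex hull of the points
`(i, val aᵢ)` with `aᵢ ≠ 0`. -/
def newtonPolygon (F : L⟦X⟧[X]) : Set (ℝ × ℝ) :=
  lowerHull {p | ∃ i n : ℕ, (F.coeff i).order = n ∧ p = ((i : ℝ), (n : ℝ))}

open Classical in
/-- The boundary polynomial of `F = ∑ aᵢⱼ xʲ yⁱ`: the sum of the terms `aᵢⱼ xʲ yⁱ` with `(i, j)`
on the Newton polygon of `F`. -/
def boundaryPoly (F : L⟦X⟧[X]) : L⟦X⟧[X] :=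
  ∑ i ∈ F.support, Polynomial.monomial i (PowerSeries.mk fun j : ℕ =>
    if ((i : ℝ), (j : ℝ)) ∈ newtonPolygon F then PowerSeries.coeff j (F.coeff i) else 0)

/-- For `P = ∑ pᵢ Zⁱ` of degree `ℓ`, the quasi-homogeneous polynomial
`P(y^q / x^m) x^(m ℓ) = ∑ pᵢ x^(m (ℓ - i)) y^(q i)`. -/
def quasiHom (q m : ℕ) (P : L[X]) : L⟦X⟧[X] :=
  ∑ i ∈ Finset.range (P.natDegree + 1), Polynomial.monomial (q * i)
    (PowerSeries.monomial (m * (P.natDegree - i)) (P.coeff i))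

/-- The coefficient of `y^(N-1)` of `F`, divided by `-N`, with `N` the degree of `F`. -/
def center (F : L⟦X⟧[X]) : L⟦X⟧ :=
  -(PowerSeries.C ((F.natDegree : L)⁻¹) * F.coeff (F.natDegree - 1))

/-- `F(x, y + c(x))`. -/
def shift (c : L⟦X⟧) : L⟦X⟧[X] →+* L⟦X⟧[X] :=
  Polynomial.eval₂RingHom Polynomial.C (Polynomial.X + Polynomial.C c)

variable (L) in
/-- A tuple `(q, m, P, N)` with `q ≠ 0` and `P` irreducible. -/
structure EdgeData where
  q : ℕ
  m : ℕ
  P : L[X]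
  N : ℕ
  q_ne_zero : q ≠ 0
  irreducible : Irreducible P

/-- `D = (q, m, P, N)` is the edge data of `H`, which is thus degenerated: `q` and `m` are coprime,
`P` is monic (and irreducible) with `P ≠ Z`, and the boundary polynomial of `H` is
`c (P(y^q / x^m) x^(m deg P))^N`. The Newton polygon of `H` is then a segment of slope `-m/q`. -/
structure EdgeData.IsEdgeDataOf (D : EdgeData L) (H : L⟦X⟧[X]) : Prop where
  coprime : Nat.Coprime D.q D.m
  monic : D.P.Monic
  coeff_zero_ne : D.P.coeff 0 ≠ 0
  boundary_eq : ∃ c : L, c ≠ 0 ∧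
    boundaryPoly H = Polynomial.C (PowerSeries.C c) * (quasiHom D.q D.m D.P) ^ D.N

instance (D : EdgeData L) : Fact (Irreducible D.P) := ⟨D.irreducible⟩

/-- The field extension `L[Z]/(P(Z))`. -/
abbrev EdgeData.Ext (D : EdgeData L) : Type u := AdjoinRoot D.P

/-- The residue class `z` of `Z` in `L[Z]/(P(Z))`. -/
def EdgeData.z (D : EdgeData L) : D.Ext := AdjoinRoot.root D.P

/-- The map `a(x) ↦ a(z^t x^q)` from `L[[x]]` to `(L[Z]/P)[[x]]`. -/
def EdgeData.substX (D : EdgeData L) (t : ℕ) : L⟦X⟧ →+* D.Ext⟦X⟧ :=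
  ((PowerSeries.expand D.q D.q_ne_zero : D.Ext⟦X⟧ →ₐ[D.Ext] D.Ext⟦X⟧) : D.Ext⟦X⟧ →+* D.Ext⟦X⟧).comp
    ((PowerSeries.rescale (D.z ^ t)).comp (PowerSeries.map (AdjoinRoot.of D.P)))

/-- The pull-back `H(x, y) ↦ H(z^t x^q, x^m (y + z^s + c(x)))`. -/
def EdgeData.sigma (D : EdgeData L) (s t : ℕ) (c : D.Ext⟦X⟧) : L⟦X⟧[X] →+* D.Ext⟦X⟧[X] :=
  Polynomial.eval₂RingHom (Polynomial.C.comp (D.substX t))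
    (Polynomial.C (PowerSeries.X ^ D.m) *
      (Polynomial.X + Polynomial.C (PowerSeries.C (D.z ^ s) + c)))

/-- `H(z^t x^q, x^m (y + z^s)) = x^(q m ℓ N) G V` in `(L[Z]/P)[[x, y]]`, with `G` a Weierstrass
polynomial of degree `N` and `V` a unit. -/
def EdgeData.IsTransform (D : EdgeData L) (s t : ℕ) (H : L⟦X⟧[X]) (G : D.Ext⟦X⟧[X]) : Prop :=
  IsWeierstrass G ∧ G.natDegree = D.N ∧ ∃ V : D.Ext⟦X⟧⟦X⟧, IsUnit V ∧
    ((D.sigma s t 0 H : D.Ext⟦X⟧[X]) : D.Ext⟦X⟧⟦X⟧) =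
      PowerSeries.C (PowerSeries.X ^ (D.q * D.m * D.P.natDegree * D.N)) * (G : D.Ext⟦X⟧⟦X⟧) * V

end Boundary

/-- The valuation of `L[[x]][y]` in `x`: the minimum of the valuations of the coefficients. -/
def xVal {L : Type u} [Field L] (H : L⟦X⟧[X]) : ℕ∞ := ⨅ i : ℕ, (H.coeff i).order

/-- The trailing coefficient in `y` of `(H / x^v)` at `x = 0`, with `v` the `x`-valuation of `H`
(and `0` for `H = 0`). -/
def xTrailing {L : Type u} [Field L] (H : L⟦X⟧[X]) : L :=
  (∑ i ∈ H.support, Polynomial.monomial i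
    (PowerSeries.coeff (xVal H).toNat (H.coeff i))).trailingCoeff

/-- What is known at rank `k` of the sequence attached to a polynomial over `K[[x]]`: the field
`L = K_k`, the polynomial `H = H_k`, the pull-back morphism `pull = π_k^*`, the minimal polynomials
`φ_0, …, φ_(k-1)` and the products `q_1 ℓ_1, …, q_k ℓ_k`. -/
structure Stage (K : Type u) [Field K] where
  k : ℕ
  L : Type u
  [field : Field L]
  [algebra : Algebra K L]
  H : L⟦X⟧[X]
  pull : K⟦X⟧[X] →+* L⟦X⟧[X]
  phi : Fin k → K⟦X⟧[X]
  bound : Fin k → ℕ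

attribute [instance] Stage.field Stage.algebra

variable {K : Type u} [Field K]

namespace Stage

/-- Rank `0`: `K_0 = K`, `π_0 = (x, y + c_0(x))` and `H_0 = F(x, y + c_0(x))`. -/
@[reducible] def init (F : K⟦X⟧[X]) : Stage K where
  k := 0
  L := K
  H := shift (center F) F
  pull := shift (center F)
  phi := Fin.elim0
  bound := Fin.elim0

/-- The embedding of `K[[x]]` into `L[[x]]` by `x ↦ μ x^e`, the first coordinate of `π(x, 0)`. -/
def paramX (S : Stage K) : K⟦X⟧ →+* S.L⟦X⟧ :=
  (Polynomial.evalRingHom 0).comp (S.pull.comp Polynomial.C)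

/-- The second coordinate `S(x)` of `π(x, 0)`. -/
def paramY (S : Stage K) : S.L⟦X⟧ := (S.pull Polynomial.X).eval 0

/-- The minimal polynomial of `S(x)` over `K[[x]]`, embedded in `L[[x]]` by `x ↦ μ x^e`. -/
def minPoly (S : Stage K) : K⟦X⟧[X] :=
  letI : Algebra K⟦X⟧ S.L⟦X⟧ := S.paramX.toAlgebra
  minpoly K⟦X⟧ S.paramY

/-- The passage from rank `k - 1` to rank `k`, with `c_k` the centre of `G = G_k`:
`H_k = G_k(x, y + c_k(x))` and `π_k^* = σ_k^* ∘ π_(k-1)^*`. -/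
@[reducible] def next (S : Stage K) (D : EdgeData S.L) (s t : ℕ) (G : D.Ext⟦X⟧[X]) : Stage K where
  k := S.k + 1
  L := D.Ext
  H := shift (center G) G
  pull := (D.sigma s t (center G)).comp S.pull
  phi := Fin.snoc (α := fun _ => K⟦X⟧[X]) S.phi S.minPoly
  bound := Fin.snoc (α := fun _ => ℕ) S.bound (D.q * D.P.natDegree)

/-- `S` is one of the stages, of rank `0 ≤ S.k ≤ g`, of the sequence attached to `F`. -/
inductive Reach (F : K⟦X⟧[X]) : Stage K → Prop
  | init : Reach F (init F)
  | next (S : Stage K) (D : EdgeData S.L) (s t : ℕ) (G : D.Ext⟦X⟧[X])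
      (hS : Reach F S) (hD : D.IsEdgeDataOf S.H)
      (hst : D.q * s = t * D.m + 1) (ht : t < D.q)
      (hG : D.IsTransform s t S.H G) : Reach F (S.next D s t G)

variable (S : Stage K)

/-- `v_k(H)`, the `x`-valuation of `π_k^* H`. -/
def val (H : K⟦X⟧[X]) : ℕ∞ := xVal (S.pull H)

/-- `λ_k(H)`, the trailing coefficient of `π_k^* H / x^(v_k(H))` at `x = 0`. -/
def lam (H : K⟦X⟧[X]) : S.L := xTrailing (S.pull H)

/-- The family `Φ = (φ_(-1), φ_0, …, φ_k)` with `φ_(-1) = x`. Such families have index set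
`Fin (k + 2)`, with `0` for the index `-1` and the last element for the index `k`. -/
def Phi : Fin (S.k + 2) → K⟦X⟧[X] :=
  Fin.cons (α := fun _ => K⟦X⟧[X]) (Polynomial.C PowerSeries.X)
    (Fin.snoc (α := fun _ => K⟦X⟧[X]) S.phi S.minPoly)

/-- The set `𝓑` of the `B = (b_(-1), …, b_k)` with `b_(i-1) < q_i ℓ_i` for `1 ≤ i ≤ k`. -/
def expSet : Set (Fin (S.k + 2) → ℕ) := {B | ∀ i : Fin S.k, B i.castSucc.succ < S.bound i}

/-- `V = v_k(Φ)`. -/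
def V (j : Fin (S.k + 2)) : ℕ∞ := S.val (S.Phi j)

/-- `Λ = λ_k(Φ)`. -/
def Lam (j : Fin (S.k + 2)) : S.L := S.lam (S.Phi j)

/-- The scalar product `⟨B, V⟩`. -/
def pairing (B : Fin (S.k + 2) → ℕ) : ℕ∞ := ∑ j, (B j : ℕ∞) * S.V j

/-- The set `𝓑(i, w)` of the `B ∈ 𝓑` with `b_k = i` and `⟨B, V⟩ = w`. -/
def expSetAt (i : ℕ) (w : ℕ∞) : Set (Fin (S.k + 2) → ℕ) :=
  {B | B ∈ S.expSet ∧ B (Fin.last _) = i ∧ S.pairing B = w}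

/-- `B_0 = (0, …, 0, N_k)`. -/
def B0 : Fin (S.k + 2) → ℕ := Pi.single (Fin.last _) S.H.natDegree

/-- `f` is the family of coefficients of the `Φ`-adic expansion `F = ∑_{B ∈ 𝓑} f_B Φ^B`: only
finitely many exponents `b = (b_0, …, b_k)` occur, each one with a coefficient
`∑_n f_(n, b) x^n` in `K[[x]]`. -/
def IsExpansion (F : K⟦X⟧[X]) (f : (Fin (S.k + 2) → ℕ) → K) : Prop :=
  (∀ B, f B ≠ 0 → B ∈ S.expSet) ∧
  ∃ T : Finset (Fin (S.k + 1) → ℕ),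
    (∀ (n : ℕ) (b : Fin (S.k + 1) → ℕ), f (Fin.cons n b) ≠ 0 → b ∈ T) ∧
    F = ∑ b ∈ T, Polynomial.C (PowerSeries.mk fun n => f (Fin.cons n b)) *
      ∏ j : Fin (S.k + 1), S.Phi j.succ ^ b j

/-- `min {⟨B, V⟩ | b_k = i, f_B ≠ 0}`, which is `∞` if there is no such `B`. -/
def minVal (f : (Fin (S.k + 2) → ℕ) → K) (i : ℕ) : ℕ∞ :=
  ⨅ (B : Fin (S.k + 2) → ℕ) (_ : B (Fin.last _) = i ∧ f B ≠ 0), S.pairing B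

/-- `w_i = min {⟨B, V⟩ | b_k = i, f_B ≠ 0} - v_k(F)`. -/
def w (F : K⟦X⟧[X]) (f : (Fin (S.k + 2) → ℕ) → K) (i : ℕ) : ℕ∞ := S.minVal f i - S.val F

open Classical in
/-- The indices `0 ≤ i ≤ N_k` for which `(i, w_i)` is on the Newton polygon of `H_k`. -/
def edgeIndices (F : K⟦X⟧[X]) (f : (Fin (S.k + 2) → ℕ) → K) : Finset ℕ :=
  (Finset.range (S.H.natDegree + 1)).filter fun i =>
    ∃ n : ℕ, S.w F f i = n ∧ ((i : ℝ), (n : ℝ)) ∈ newtonPolygon S.H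

end Stage

end NewtonPuiseux

end

/-! The point is that `π_k^*` turns every monomial of the `Φ`-adic expansion into a monomial in `x,
y` times a series whose value at the origin is known and non-zero: `φ_(-1), …, φ_(k-1)` become
powers of `x` times such a series, and `φ_k` becomes a power of `x` times `y` times such a series.
Hence `π_k^* Φ^B = x^⟨B,V⟩ y^(b_k) U` with `U(0,0) = Λ^B`. Group the expansion of `F` by `i = b_k`.
Group `i` pulls back to `x^w y^i U`, where `w` is its least weight and `U(0,0)` is the sum of the
`f_B Λ^B` of that weight. This sum is non-zero because the `Λ^B` with `B` in `𝓑`, of given weight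
and given `b_k`, are linearly independent over `K` (`IndepOn`).

On the other side `π_k^* F = x^a H_k W` with `W(0,0) ≠ 0`. Along a supporting line of the Newton
polygon of `H_k` the groups cannot cancel each other, and `W` acts only through `W(0,0)`
(`coeff_eq_of_eq_sum_lead`). So the boundary coefficients of `H_k`, multiplied by `W(0,0)`, are the
leading sums. At the point `(N_k, 0)` the only term is `φ_k^(N_k)`, which gives `W(0,0) = Λ^(B_0)`.

The shape of the pull-backs is proved by induction on the rank (`Reach.exists_isFullChain`). Under
`σ`, a term of weight `u` with last exponent `i` gets the weight `w = q u + m i` and the factor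
`z^(t u + s i)`. Since `q s - t m = 1`, we have `q (t u + s i) = t w + i`. For fixed `w` and `i < q
ℓ` these exponents are distinct and lie among `ℓ` consecutive integers, so the independence of `1,
z, …, z^(ℓ-1)` separates the values of `i` (`eq_zero_of_quasi_sum_eq_zero`). Independence in turn
shows that a non-zero polynomial of degree `< d = ∏ q_i ℓ_i` cannot vanish on the parametrisation,
while `K_k[[x]]` is spanned by `d` elements over `K[[x]]`; so `deg φ_k = d` (`minPoly_spec`).
Finally, expand the new `φ_k` in the old family, with `i ≤ q ℓ`. The polynomial in `z` that
expresses its vanishing is a constant multiple of `P`, and its derivative does not vanish at `z`,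
because `q` and `ℓ` divide `deg F` and are thus non-zero in `K`. So the pull-back of `φ_k` contains
`y` exactly once (`exists_lead_sigma`). -/

noncomputable section

namespace NewtonPuiseux

/-! ### Leading terms in `L[[x]][y]` and Weierstrass polynomials. -/

section Lead

variable {L : Type u} [Field L]

variable (L) in
/-- Reduction modulo `x`, from `L[[x]][y]` to `L[y]`. -/
def residue : L⟦X⟧[X] →+* L[X] := Polynomial.mapRingHom PowerSeries.constantCoeff

variable (L) in
/-- The value at the origin of an element of `L[[x]][y]`. -/
def origin : L⟦X⟧[X] →+* L := Polynomial.constantCoeff.comp (residue L)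

@[simp] lemma residue_coeff (G : L⟦X⟧[X]) (i : ℕ) :
    (residue L G).coeff i = PowerSeries.constantCoeff (G.coeff i) := by
  simp [residue]

@[simp] lemma residue_C (a : L⟦X⟧) :
    residue L (Polynomial.C a) = Polynomial.C (PowerSeries.constantCoeff a) := by
  simp [residue]

@[simp] lemma residue_X : residue L Polynomial.X = Polynomial.X := by simp [residue]

lemma origin_apply (G : L⟦X⟧[X]) :
    origin L G = PowerSeries.constantCoeff (G.coeff 0) := by
  simp [origin, Polynomial.constantCoeff_apply]

lemma origin_eq (G : L⟦X⟧[X]) : origin L G = (residue L G).coeff 0 := by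
  simp [origin_apply]

@[simp] lemma origin_C (a : L⟦X⟧) :
    origin L (Polynomial.C a) = PowerSeries.constantCoeff a := by simp [origin_apply]

/-- `G = x^a y^i U` with `U(0, 0) = α`. -/
def HasLead (G : L⟦X⟧[X]) (a i : ℕ) (α : L) : Prop :=
  ∃ U, G = Polynomial.C (PowerSeries.X ^ a) * Polynomial.X ^ i * U ∧ origin L U = α

namespace HasLead

lemma zero (a i : ℕ) : HasLead (0 : L⟦X⟧[X]) a i 0 := ⟨0, by simp, by simp⟩

lemma one : HasLead (1 : L⟦X⟧[X]) 0 0 1 := ⟨1, by simp, by simp⟩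

lemma mul {G G' : L⟦X⟧[X]} {a a' i i' : ℕ} {α α' : L} (h : HasLead G a i α)
    (h' : HasLead G' a' i' α') : HasLead (G * G') (a + a') (i + i') (α * α') := by
  obtain ⟨U, rfl, rfl⟩ := h
  obtain ⟨U', rfl, rfl⟩ := h'
  refine ⟨U * U', ?_, by simp⟩
  rw [pow_add, pow_add, Polynomial.C_mul]
  ring

lemma pow {G : L⟦X⟧[X]} {a i : ℕ} {α : L} (h : HasLead G a i α) (n : ℕ) :
    HasLead (G ^ n) (n * a) (n * i) (α ^ n) := by
  induction n with
  | zero => simpa using one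
  | succ n ih => simpa [pow_succ, add_mul] using ih.mul h

lemma prod {ι : Type*} (s : Finset ι) {G : ι → L⟦X⟧[X]} {a i : ι → ℕ} {α : ι → L}
    (h : ∀ j ∈ s, HasLead (G j) (a j) (i j) (α j)) :
    HasLead (∏ j ∈ s, G j) (∑ j ∈ s, a j) (∑ j ∈ s, i j) (∏ j ∈ s, α j) := by
  classical
  induction s using Finset.induction_on with
  | empty => simpa using one
  | insert j s hj ih =>
    rw [Finset.prod_insert hj, Finset.sum_insert hj, Finset.sum_insert hj, Finset.prod_insert hj]
    exact (h j (by simp)).mul (ih fun k hk => h k (by simp [hk]))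

lemma add {G G' : L⟦X⟧[X]} {a i : ℕ} {α α' : L} (h : HasLead G a i α)
    (h' : HasLead G' a i α') : HasLead (G + G') a i (α + α') := by
  obtain ⟨U, rfl, rfl⟩ := h
  obtain ⟨U', rfl, rfl⟩ := h'
  exact ⟨U + U', by ring, by simp⟩

lemma sum {ι : Type*} (s : Finset ι) {G : ι → L⟦X⟧[X]} {a i : ℕ} {α : ι → L}
    (h : ∀ j ∈ s, HasLead (G j) a i (α j)) :
    HasLead (∑ j ∈ s, G j) a i (∑ j ∈ s, α j) := by
  classical
  induction s using Finset.induction_on with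
  | empty => simpa using zero a i
  | insert j s hj ih =>
    rw [Finset.sum_insert hj, Finset.sum_insert hj]
    exact (h j (by simp)).add (ih fun k hk => h k (by simp [hk]))

/-- Lets the terms above the minimal weight enter a sum at that weight, with contribution zero. -/
lemma weaken {G : L⟦X⟧[X]} {a b i : ℕ} {α : L} (h : HasLead G a i α) (hb : b < a) :
    HasLead G b i 0 := by
  obtain ⟨U, rfl, rfl⟩ := h
  obtain ⟨c, rfl⟩ := Nat.exists_eq_add_of_lt hb
  refine ⟨Polynomial.C (PowerSeries.X ^ (c + 1)) * U, ?_, by simp⟩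
  rw [add_assoc, pow_add, Polynomial.C_mul]
  ring

lemma coeff_coeff {G : L⟦X⟧[X]} {a i : ℕ} {α : L} (h : HasLead G a i α) :
    PowerSeries.coeff a (G.coeff i) = α := by
  obtain ⟨U, rfl, rfl⟩ := h
  rw [mul_assoc, Polynomial.coeff_C_mul, mul_comm (Polynomial.X ^ i), Polynomial.coeff_mul_X_pow',
    if_pos le_rfl, Nat.sub_self, PowerSeries.coeff_X_pow_mul', if_pos le_rfl, Nat.sub_self,
    origin_apply, PowerSeries.coeff_zero_eq_constantCoeff]

lemma coeff_coeff_eq_zero {G : L⟦X⟧[X]} {a i : ℕ} {α : L} (h : HasLead G a i α) {a' i' : ℕ}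
    (h' : a' < a ∨ i' < i) : PowerSeries.coeff a' (G.coeff i') = 0 := by
  obtain ⟨U, rfl, rfl⟩ := h
  rw [mul_assoc, Polynomial.coeff_C_mul, mul_comm (Polynomial.X ^ i), Polynomial.coeff_mul_X_pow',
    PowerSeries.coeff_X_pow_mul']
  split_ifs <;> first | rfl | simp | omega

lemma ne_zero {G : L⟦X⟧[X]} {a i : ℕ} {α : L} (h : HasLead G a i α) (hα : α ≠ 0) : G ≠ 0 := by
  rintro rfl
  exact hα (by simpa using h.coeff_coeff.symm)

lemma xVal_eq {G : L⟦X⟧[X]} {a i : ℕ} {α : L} (h : HasLead G a i α) (hα : α ≠ 0) :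
    xVal G = a := by
  apply le_antisymm
  · exact (iInf_le _ i).trans (PowerSeries.order_le _ (by rwa [h.coeff_coeff]))
  · exact le_iInf fun j => PowerSeries.nat_le_order _ _ fun n hn =>
      h.coeff_coeff_eq_zero (Or.inl hn)

lemma xTrailing_eq {G : L⟦X⟧[X]} {a i : ℕ} {α : L} (h : HasLead G a i α) (hα : α ≠ 0) :
    xTrailing G = α := by
  unfold xTrailing
  rw [h.xVal_eq hα, ENat.toNat_natCast]
  set p : L[X] := ∑ i ∈ G.support, Polynomial.monomial i (PowerSeries.coeff a (G.coeff i))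
  have hp : ∀ j, p.coeff j = PowerSeries.coeff a (G.coeff j) := by
    intro j
    simp only [p, Polynomial.finsetSum_coeff, Polynomial.coeff_monomial]
    rw [Finset.sum_ite_eq' G.support j]
    split_ifs with hj
    · rfl
    · simp [Polynomial.notMem_support_iff.1 hj]
  have hn : p.natTrailingDegree = i := by
    apply le_antisymm
    · exact Polynomial.natTrailingDegree_le_of_ne_zero (by rwa [hp, h.coeff_coeff])
    · refine Polynomial.le_natTrailingDegree ?_ fun j hj => ?_
      · intro h0
        apply hα
        rw [← h.coeff_coeff, ← hp, h0, Polynomial.coeff_zero]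
      · rw [hp, h.coeff_coeff_eq_zero (Or.inr hj)]
  rw [Polynomial.trailingCoeff, hn, hp, h.coeff_coeff]

end HasLead

lemma isWeierstrass_iff (F : L⟦X⟧[X]) :
    IsWeierstrass F ↔ F.Monic ∧ 0 < F.natDegree ∧ residue L F = Polynomial.X ^ F.natDegree := by
  constructor
  · intro h
    refine ⟨h.monic, h.degree_pos, ?_⟩
    ext i
    rw [residue_coeff, Polynomial.coeff_X_pow]
    rcases lt_trichotomy i F.natDegree with hi | rfl | hi
    · rw [h.coeff_zero i hi, if_neg hi.ne]
    · simp [h.monic.coeff_natDegree]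
    · rw [Polynomial.coeff_eq_zero_of_natDegree_lt hi, map_zero, if_neg hi.ne']
  · rintro ⟨h1, h2, h3⟩
    refine ⟨h1, h2, fun i hi => ?_⟩
    rw [← residue_coeff, h3, Polynomial.coeff_X_pow, if_neg hi.ne]

@[simp] lemma shift_C (c a : L⟦X⟧) : shift c (Polynomial.C a) = Polynomial.C a := by
  simp [shift]

@[simp] lemma shift_X (c : L⟦X⟧) :
    shift c Polynomial.X = Polynomial.X + Polynomial.C c := by
  simp [shift]

lemma shift_eq_comp (c : L⟦X⟧) (G : L⟦X⟧[X]) :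
    shift c G = G.comp (Polynomial.X + Polynomial.C c) := rfl

lemma residue_shift (c : L⟦X⟧) (hc : PowerSeries.constantCoeff c = 0) (G : L⟦X⟧[X]) :
    residue L (shift c G) = residue L G := by
  have : (residue L).comp (shift c) = residue L := by
    apply Polynomial.ringHom_ext
    · intro a; simp
    · simp [hc]
  exact congrArg (fun f : L⟦X⟧[X] →+* L[X] => f G) this

lemma origin_shift (c : L⟦X⟧) (hc : PowerSeries.constantCoeff c = 0) (G : L⟦X⟧[X]) :
    origin L (shift c G) = origin L G := by
  rw [origin_eq, residue_shift c hc, origin_eq]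

lemma natDegree_shift (c : L⟦X⟧) (G : L⟦X⟧[X]) : (shift c G).natDegree = G.natDegree := by
  rw [shift_eq_comp, Polynomial.natDegree_comp, Polynomial.natDegree_X_add_C, mul_one]

lemma IsWeierstrass.constantCoeff_center {G : L⟦X⟧[X]} (h : IsWeierstrass G) :
    PowerSeries.constantCoeff (center G) = 0 := by
  simp [center, h.coeff_zero (G.natDegree - 1) (Nat.sub_lt h.degree_pos one_pos)]

lemma IsWeierstrass.shift {G : L⟦X⟧[X]} (h : IsWeierstrass G) {c : L⟦X⟧}
    (hc : PowerSeries.constantCoeff c = 0) : IsWeierstrass (shift c G) := by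
  rw [isWeierstrass_iff] at *
  refine ⟨?_, ?_, ?_⟩
  · rw [shift_eq_comp]
    exact h.1.comp (Polynomial.monic_X_add_C c) (by simp)
  · rw [natDegree_shift]; exact h.2.1
  · rw [natDegree_shift, residue_shift c hc, h.2.2]

lemma eq_zero_of_forall_X_pow_dvd {a : L⟦X⟧} (h : ∀ n, PowerSeries.X ^ n ∣ a) : a = 0 := by
  ext n
  exact PowerSeries.X_pow_dvd_iff.1 (h (n + 1)) n (Nat.lt_succ_self n)

/-- Uniqueness in the Weierstrass division theorem. -/
lemma IsWeierstrass.eq_zero_of_mul_eq {G : L⟦X⟧[X]} (hG : IsWeierstrass G) {D : L⟦X⟧⟦X⟧}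
    (h : ∀ i, PowerSeries.coeff (i + G.natDegree) (D * (G : L⟦X⟧⟦X⟧)) = 0) : D = 0 := by
  -- Modulo `x` the polynomial `G` is a power of `y`, so each vanishing coefficient of `D * G`
  -- yields one more factor `x` in a coefficient of `D`.
  have key : ∀ n i, PowerSeries.X ^ n ∣ PowerSeries.coeff i D := by
    intro n
    induction n with
    | zero => simp
    | succ n ih =>
      intro i
      have h1 := h i
      rw [PowerSeries.coeff_mul, ← Finset.add_sum_erase _ _
        (show (i, G.natDegree) ∈ Finset.HasAntidiagonal.antidiagonal (i + G.natDegree) by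
          simp)] at h1
      simp only [Polynomial.coeff_coe, hG.monic.coeff_natDegree, mul_one] at h1
      rw [eq_neg_of_add_eq_zero_left h1, dvd_neg]
      refine Finset.dvd_sum fun p hp => ?_
      rw [Finset.mem_erase, Finset.HasAntidiagonal.mem_antidiagonal] at hp
      rcases lt_trichotomy p.2 G.natDegree with hl | hl | hl
      · rw [pow_succ]
        exact mul_dvd_mul (ih _) (PowerSeries.X_dvd_iff.2 (hG.coeff_zero _ hl))
      · exact absurd (Prod.ext (by simp; omega) hl) hp.1
      · rw [Polynomial.coeff_eq_zero_of_natDegree_lt hl, mul_zero]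
        exact dvd_zero _
  ext1 i
  exact eq_zero_of_forall_X_pow_dvd fun n => key n i

/-- A power series in `y` that is the quotient of a polynomial by a Weierstrass polynomial is
itself a polynomial. -/
lemma IsWeierstrass.exists_polynomial {G P : L⟦X⟧[X]} (hG : IsWeierstrass G) {n : ℕ}
    {V : L⟦X⟧⟦X⟧} (h : (P : L⟦X⟧⟦X⟧) = PowerSeries.C (PowerSeries.X ^ n) * (G : L⟦X⟧⟦X⟧) * V) :
    ∃ W : L⟦X⟧[X], (W : L⟦X⟧⟦X⟧) = V ∧ P = Polynomial.C (PowerSeries.X ^ n) * G * W := by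
  -- Multiplied by `G`, this difference is the Euclidean remainder, which has degree less than that
  -- of `G`.
  have hQ : PowerSeries.C (PowerSeries.X ^ n) * V - ((P /ₘ G : L⟦X⟧[X]) : L⟦X⟧⟦X⟧) = 0 := by
    refine hG.eq_zero_of_mul_eq fun i => ?_
    have h1 : (PowerSeries.C (PowerSeries.X ^ n) * V - ((P /ₘ G : L⟦X⟧[X]) : L⟦X⟧⟦X⟧)) *
        (G : L⟦X⟧⟦X⟧) = ((P %ₘ G : L⟦X⟧[X]) : L⟦X⟧⟦X⟧) := by
      have h2 := congrArg (fun p : L⟦X⟧[X] => (p : L⟦X⟧⟦X⟧)) (Polynomial.modByMonic_add_div P G)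
      simp only [Polynomial.coe_add, Polynomial.coe_mul] at h2
      rw [h] at h2
      linear_combination -h2
    rw [h1, Polynomial.coeff_coe]
    apply Polynomial.coeff_eq_zero_of_degree_lt
    refine (Polynomial.degree_modByMonic_lt P hG.monic).trans_le ?_
    rw [Polynomial.degree_eq_natDegree hG.monic.ne_zero]
    exact_mod_cast Nat.le_add_left _ _
  rw [sub_eq_zero] at hQ
  have hd : ∀ i, (P /ₘ G).coeff i = PowerSeries.X ^ n * PowerSeries.coeff i V := by
    intro i
    rw [← Polynomial.coeff_coe, ← hQ, PowerSeries.coeff_C_mul]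
  have hdvd : Polynomial.C (PowerSeries.X ^ n) ∣ (P /ₘ G) :=
    Polynomial.C_dvd_iff_dvd_coeff _ _ |>.2 fun i => ⟨_, hd i⟩
  obtain ⟨W, hW⟩ := hdvd
  have hWV : (W : L⟦X⟧⟦X⟧) = V := by
    ext1 i
    have := hd i
    rw [hW, Polynomial.coeff_C_mul] at this
    rw [Polynomial.coeff_coe]
    exact mul_left_cancel₀ (pow_ne_zero n PowerSeries.X_ne_zero) this
  refine ⟨W, hWV, ?_⟩
  rw [← hWV] at h
  rw [← Polynomial.coe_inj, h]
  simp

end Lead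

/-! ### Expansions along families of monic polynomials. -/

section Expansion

variable {R ι : Type*} [CommRing R] {p : ι → R[X]}

/-- A polynomial of degree `< D` is a combination of monic polynomials, if these have all the
degrees `< D`. -/
lemma exists_sum_monic (hp : ∀ b, (p b).Monic) (E : Set ι) (D : ℕ)
    (hE : ∀ n < D, ∃ b ∈ E, (p b).natDegree = n) (G : R[X]) (hG : G.degree < D) :
    ∃ c : ι →₀ R, (∀ b ∈ c.support, b ∈ E) ∧
      G = c.sum fun b a => Polynomial.C a * p b := by
  induction D generalizing G with
  | zero =>
    refine ⟨0, by simp, ?_⟩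
    rw [Finsupp.sum_zero_index]
    simpa [Nat.WithBot.lt_zero_iff] using hG
  | succ n ih =>
    obtain ⟨b, hb, hbn⟩ := hE n (Nat.lt_succ_self n)
    obtain ⟨c, hc, hs⟩ := ih (fun m hm => hE m (hm.trans (Nat.lt_succ_self n)))
      (G - Polynomial.C (G.coeff n) * p b) (by
        rw [Polynomial.degree_lt_iff_coeff_zero] at hG ⊢
        intro m hm
        rw [Polynomial.coeff_sub, Polynomial.coeff_C_mul]
        rcases hm.eq_or_lt with rfl | hlt
        · have : (p b).coeff n = 1 := by rw [← hbn]; exact (hp b).coeff_natDegree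
          rw [this, mul_one, sub_self]
        · rw [hG m hlt, Polynomial.coeff_eq_zero_of_natDegree_lt (hbn.trans_lt hlt), mul_zero,
            sub_zero])
    classical
    refine ⟨c + Finsupp.single b (G.coeff n), fun b' hb' => ?_, ?_⟩
    · rcases Finset.mem_union.1 (Finsupp.support_add hb') with h | h
      · exact hc b' h
      · rw [Finset.mem_singleton.1 (Finsupp.support_single_subset h)]; exact hb
    · rw [Finsupp.sum_add_index' (by simp) (by intros; rw [Polynomial.C_add, add_mul]), ← hs,
        Finsupp.sum_single_index (by simp)]
      ring

/-- Degrees being distinct on `E`, only one member of the family reaches the top degree. Uniqueness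
of expansions rests on this. -/
lemma coeff_sum_monic (hp : ∀ b, (p b).Monic) {E : Set ι}
    (hinj : Set.InjOn (fun b => (p b).natDegree) E) {c : ι →₀ R} (hc : ∀ b ∈ c.support, b ∈ E)
    {b : ι} (hb : b ∈ E) (hmax : ∀ b' ∈ c.support, (p b').natDegree ≤ (p b).natDegree) :
    (c.sum fun b a => Polynomial.C a * p b).coeff (p b).natDegree = c b := by
  rw [Finsupp.sum, Polynomial.finsetSum_coeff, Finset.sum_eq_single b]
  · rw [Polynomial.coeff_C_mul, (hp b).coeff_natDegree, mul_one]
  · intro b' hb' hne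
    rw [Polynomial.coeff_C_mul, Polynomial.coeff_eq_zero_of_natDegree_lt, mul_zero]
    exact lt_of_le_of_ne (hmax b' hb') fun h => hne (hinj (hc b' hb') hb h)
  · intro h
    rw [Finsupp.notMem_support_iff.1 h]
    simp

/-- The degree of a combination of monic polynomials of distinct degrees. -/
lemma natDegree_lt_of_sum_monic (hp : ∀ b, (p b).Monic) {E : Set ι}
    (hinj : Set.InjOn (fun b => (p b).natDegree) E) {c : ι →₀ R} (hc : ∀ b ∈ c.support, b ∈ E)
    {D : ℕ} (hD : (c.sum fun b a => Polynomial.C a * p b).degree < D) {b : ι}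
    (hb : b ∈ c.support) : (p b).natDegree < D := by
  obtain ⟨b', hb', hmax⟩ := Finset.exists_max_image c.support (fun b => (p b).natDegree) ⟨b, hb⟩
  have h1 := coeff_sum_monic hp hinj hc (hc b' hb') hmax
  by_contra hlt
  push Not at hlt
  rw [(Polynomial.degree_lt_iff_coeff_zero _ _).1 hD _ (hlt.trans (hmax b hb))] at h1
  exact Finsupp.mem_support_iff.1 hb' h1.symm

lemma eq_zero_of_sum_monic (hp : ∀ b, (p b).Monic) {E : Set ι}
    (hinj : Set.InjOn (fun b => (p b).natDegree) E) {c : ι →₀ R} (hc : ∀ b ∈ c.support, b ∈ E)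
    (h0 : (c.sum fun b a => Polynomial.C a * p b) = 0) : c = 0 := by
  by_contra hne
  obtain ⟨b, hb⟩ := Finsupp.support_nonempty_iff.2 hne
  exact absurd (natDegree_lt_of_sum_monic hp hinj hc (D := 0) (by rw [h0]; simp) hb)
    (Nat.not_lt_zero _)

end Expansion

/-! ### Mixed-radix numeration, for the degrees of the monomials in `φ_0, …, φ_k`. -/

section MixedRadix

variable {k : ℕ} {d : Fin (k + 1) → ℕ} {r : Fin k → ℕ}

lemma radix_last (h0 : d 0 = 1) (hs : ∀ i : Fin k, d i.succ = r i * d i.castSucc) :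
    d (Fin.last k) = ∏ i, r i := by
  induction k with
  | zero => simpa using h0
  | succ k ih =>
    rw [← Fin.succ_last, hs, Fin.prod_univ_castSucc, mul_comm]
    congr 1
    exact ih (d := fun i => d i.castSucc) (r := fun i => r i.castSucc) h0
      (fun i => by simpa using hs i.castSucc)

lemma radix_lt (h0 : d 0 = 1) (hs : ∀ i : Fin k, d i.succ = r i * d i.castSucc)
    {b : Fin k → ℕ} (hb : ∀ i, b i < r i) : ∑ i, b i * d i.castSucc < d (Fin.last k) := by
  induction k with
  | zero => simp [h0]
  | succ k ih =>
    have h1 := ih (d := fun i => d i.castSucc) (r := fun i => r i.castSucc) h0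
      (fun i => by simpa using hs i.castSucc) (fun i => hb i.castSucc)
    rw [Fin.sum_univ_castSucc, ← Fin.succ_last, hs]
    have h2 : (b (Fin.last k) + 1) * d (Fin.last k).castSucc ≤
      r (Fin.last k) * d (Fin.last k).castSucc := Nat.mul_le_mul_right _ (hb _)
    rw [add_mul, one_mul] at h2
    omega

/-- The `d i` are place values, with digits below `r i` except for the last digit, which is free.
With `radix_exists`, every integer is the degree of exactly one admissible monomial. -/
lemma radix_injOn (h0 : d 0 = 1) (hs : ∀ i : Fin k, d i.succ = r i * d i.castSucc) :
    Set.InjOn (fun b : Fin (k + 1) → ℕ => ∑ j, b j * d j)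
      {b | ∀ i : Fin k, b i.castSucc < r i} := by
  induction k with
  | zero =>
    intro b _ b' _ h
    funext j
    rw [Fin.fin_one_eq_zero j]
    simpa [h0] using h
  | succ k ih =>
    intro b hb b' hb' h
    have hs' : ∀ i : Fin k, d i.succ.castSucc = r i.castSucc * d i.castSucc.castSucc := fun i => by
      simpa using hs i.castSucc
    simp only at h
    rw [Fin.sum_univ_castSucc, Fin.sum_univ_castSucc (f := fun j => b' j * d j)] at h
    have l1 := radix_lt h0 hs (b := fun i => b i.castSucc) hb
    have l2 := radix_lt h0 hs (b := fun i => b' i.castSucc) hb'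
    set D := d (Fin.last (k + 1))
    have hlast : b (Fin.last (k + 1)) = b' (Fin.last (k + 1)) := by
      have e1 := congrArg (· / D) h
      have hD : 0 < D := by omega
      rwa [Nat.add_mul_div_right _ _ hD, Nat.add_mul_div_right _ _ hD, Nat.div_eq_of_lt l1,
        Nat.div_eq_of_lt l2, zero_add, zero_add] at e1
    rw [hlast, Nat.add_right_cancel_iff] at h
    have hinit := ih (d := fun i => d i.castSucc) (r := fun i => r i.castSucc) h0 hs'
      (x₁ := fun i => b i.castSucc) (fun i => hb i.castSucc)
      (x₂ := fun i => b' i.castSucc) (fun i => hb' i.castSucc) h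
    funext j
    refine Fin.lastCases hlast (fun i => ?_) j
    exact congrFun hinit i

lemma radix_exists (h0 : d 0 = 1) (hs : ∀ i : Fin k, d i.succ = r i * d i.castSucc)
    (hr : ∀ i, 0 < r i) (n : ℕ) :
    ∃ b : Fin (k + 1) → ℕ, (∀ i : Fin k, b i.castSucc < r i) ∧ ∑ j, b j * d j = n := by
  induction k generalizing n with
  | zero => exact ⟨fun _ => n, fun i => i.elim0, by simp [h0]⟩
  | succ k ih =>
    have hs' : ∀ i : Fin k, d i.succ.castSucc = r i.castSucc * d i.castSucc.castSucc := fun i => by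
      simpa using hs i.castSucc
    set D := d (Fin.last (k + 1)) with hDdef
    have hDr : D = r (Fin.last k) * d (Fin.last k).castSucc := by
      rw [hDdef, ← Fin.succ_last, hs]
    have hD : 0 < D := by
      rw [hDdef, radix_last h0 hs]
      exact Finset.prod_pos fun i _ => hr i
    obtain ⟨b, hb, hn⟩ := ih (d := fun i => d i.castSucc) (r := fun i => r i.castSucc) h0 hs'
      (fun i => hr _) (n % D)
    refine ⟨Fin.snoc (α := fun _ => ℕ) b (n / D), fun i => ?_, ?_⟩
    · rw [Fin.snoc_castSucc]
      refine Fin.lastCases ?_ (fun i => hb i) i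
      have : b (Fin.last k) * d (Fin.last k).castSucc ≤ n % D := by
        rw [← hn]
        exact Finset.single_le_sum (f := fun j => b j * d j.castSucc) (fun _ _ => Nat.zero_le _)
          (Finset.mem_univ _)
      have h2 := this.trans_lt (Nat.mod_lt n hD)
      rw [hDr] at h2
      exact lt_of_mul_lt_mul_right h2 (Nat.zero_le _)
    · rw [Fin.sum_univ_castSucc]
      simp only [Fin.snoc_castSucc, Fin.snoc_last]
      rw [hn, mul_comm, Nat.mod_add_div]

end MixedRadix

/-! ### Newton polygons, supporting lines and boundary terms. -/

section NewtonPolygon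

variable {L : Type u} [Field L]

/-- The points `(i, val aᵢ)` attached to `H = ∑ aᵢ(x) yⁱ`. -/
def orderPoints (H : L⟦X⟧[X]) : Set (ℝ × ℝ) :=
  {p | ∃ i n : ℕ, (H.coeff i).order = n ∧ p = ((i : ℝ), (n : ℝ))}

lemma IsWeierstrass.top_mem_orderPoints {H : L⟦X⟧[X]} (hH : IsWeierstrass H) :
    ((H.natDegree : ℝ), (0 : ℝ)) ∈ orderPoints H :=
  ⟨H.natDegree, 0, by rw [hH.monic.coeff_natDegree]; simp, by simp⟩

lemma le_natDegree_of_order_eq {H : L⟦X⟧[X]} {i n : ℕ} (h : (H.coeff i).order = n) :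
    i ≤ H.natDegree := by
  by_contra hlt
  rw [Polynomial.coeff_eq_zero_of_natDegree_lt (not_le.1 hlt), PowerSeries.order_zero] at h
  exact ENat.top_ne_natCast _ h

lemma IsWeierstrass.one_le_of_order_eq {H : L⟦X⟧[X]} (hH : IsWeierstrass H) {i n : ℕ}
    (h : (H.coeff i).order = n) (hi : i < H.natDegree) : 1 ≤ n := by
  have h1 := (PowerSeries.order_ne_zero_iff_constCoeff_eq_zero).2 (hH.coeff_zero i hi)
  rw [h] at h1
  exact Nat.one_le_iff_ne_zero.2 (by exact_mod_cast h1)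

/-- The second half-plane is bounded by the line through `(0, 1)` and `(N, 0)`: the orders below the
top degree are at least one. -/
lemma IsWeierstrass.of_mem_hull {H : L⟦X⟧[X]} (hH : IsWeierstrass H) {p : ℝ × ℝ}
    (hp : p ∈ convexHull ℝ (orderPoints H)) :
    p.1 ≤ H.natDegree ∧ (H.natDegree : ℝ) - p.1 ≤ H.natDegree * p.2 := by
  have hc : Convex ℝ {p : ℝ × ℝ | p.1 ≤ H.natDegree ∧
      (H.natDegree : ℝ) - p.1 ≤ H.natDegree * p.2} := by
    rintro ⟨x1, x2⟩ ⟨hx1, hx2⟩ ⟨y1, y2⟩ ⟨hy1, hy2⟩ a b ha hb hab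
    simp only [Set.mem_ofPred_eq, Prod.smul_mk, Prod.mk_add_mk, smul_eq_mul] at *
    have hN : (H.natDegree : ℝ) = a * H.natDegree + b * H.natDegree := by
      rw [← add_mul, hab, one_mul]
    constructor
    · nlinarith
    · have e1 := mul_le_mul_of_nonneg_left hx2 ha
      have e2 := mul_le_mul_of_nonneg_left hy2 hb
      nlinarith
  refine convexHull_min ?_ hc hp
  rintro _ ⟨i, n, hn, rfl⟩
  have hi := le_natDegree_of_order_eq hn
  refine ⟨Nat.cast_le.2 hi, ?_⟩
  rcases hi.eq_or_lt with rfl | hlt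
  · simp; positivity
  · have h1 : (1 : ℝ) ≤ n := by exact_mod_cast hH.one_le_of_order_eq hn hlt
    have h2 : (0 : ℝ) ≤ i := by positivity
    have h3 : (0 : ℝ) ≤ H.natDegree := by positivity
    simp only
    nlinarith

lemma IsWeierstrass.top_mem_newtonPolygon {H : L⟦X⟧[X]} (hH : IsWeierstrass H) :
    ((H.natDegree : ℝ), (0 : ℝ)) ∈ newtonPolygon H := by
  refine ⟨subset_convexHull ℝ _ hH.top_mem_orderPoints, fun p hp h1 => ?_⟩
  have h2 := (hH.of_mem_hull hp).2
  rw [h1, sub_self] at h2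
  exact nonneg_of_mul_nonneg_right h2 (by exact_mod_cast hH.degree_pos)

/-- Each point of the Newton polygon of a Weierstrass polynomial has a supporting line of negative
slope. -/
lemma IsWeierstrass.exists_slope {H : L⟦X⟧[X]} (hH : IsWeierstrass H) {x y : ℝ}
    (h : (x, y) ∈ newtonPolygon H) :
    ∃ r : ℝ, 0 < r ∧ ∀ i n : ℕ, PowerSeries.coeff n (H.coeff i) ≠ 0 → y + r * x ≤ n + r * i := by
  suffices ∃ r : ℝ, 0 < r ∧ ∀ i n : ℕ, (H.coeff i).order = n → y + r * x ≤ n + r * i by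
    obtain ⟨r, hr, hs⟩ := this
    refine ⟨r, hr, fun i n hn => ?_⟩
    have h0 : H.coeff i ≠ 0 := by rintro h0; simp [h0] at hn
    have h1 := hs i _ (PowerSeries.coe_toNat_order h0).symm
    have h2 := PowerSeries.order_le n hn
    rw [← PowerSeries.coe_toNat_order h0] at h2
    have h3 : (((H.coeff i).order.toNat : ℕ) : ℝ) ≤ n := by exact_mod_cast h2
    linarith
  have hNpos : (0 : ℝ) < H.natDegree := by exact_mod_cast hH.degree_pos
  obtain ⟨hx, hxy⟩ := hH.of_mem_hull h.1
  simp only at hx hxy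
  rcases hx.eq_or_lt with hxN | hlt
  · have hy : y ≤ 0 := h.2 _ (subset_convexHull ℝ _ hH.top_mem_orderPoints) hxN.symm
    -- At the right end of the polygon, a line parallel to the one through `(0, 1)` and `(N, 0)`
    -- will do.
    refine ⟨1 / H.natDegree, by positivity, fun i n hn => ?_⟩
    rw [hxN, one_div_mul_cancel hNpos.ne']
    have hi := le_natDegree_of_order_eq hn
    rcases hi.eq_or_lt with hiN | hilt
    · rw [hiN, one_div_mul_cancel hNpos.ne']
      have : (0 : ℝ) ≤ n := by positivity
      linarith
    · have h1 : (1 : ℝ) ≤ n := by exact_mod_cast hH.one_le_of_order_eq hn hilt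
      have : (0 : ℝ) ≤ 1 / H.natDegree * i := by positivity
      linarith
  · have hy : 0 < y := by
      by_contra hy
      push Not at hy
      nlinarith
    classical
    -- The slope is that of the steepest descent from `(x, y)` to a point on its right. It is
    -- positive because `(N, 0)` is such a point.
    let ord : ℕ → ℕ := fun i => (H.coeff i).order.toNat
    let slope : ℕ → ℝ := fun i => (y - ord i) / (i - x)
    let I := H.support.filter fun i : ℕ => x < i
    have hI : H.natDegree ∈ I := by
      simp only [I, Finset.mem_filter]
      exact ⟨Polynomial.natDegree_mem_support_of_nonzero hH.monic.ne_zero, hlt⟩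
    obtain ⟨k, hk, hmax⟩ := Finset.exists_max_image I slope ⟨_, hI⟩
    have hordN : ord H.natDegree = 0 := by
      simp only [ord]; rw [hH.monic.coeff_natDegree]; simp
    have hpos : 0 < slope k := by
      refine lt_of_lt_of_le ?_ (hmax _ hI)
      simp only [slope, hordN]
      apply div_pos <;> simp <;> linarith
    have hkx : x < k := (Finset.mem_filter.1 hk).2
    have hkH : H.coeff k ≠ 0 := Polynomial.mem_support_iff.1 (Finset.mem_filter.1 hk).1
    refine ⟨slope k, hpos, fun i n hn => ?_⟩
    have hordi : ord i = n := by simp only [ord, hn, ENat.toNat_natCast]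
    have hiH : H.coeff i ≠ 0 := by
      intro h0
      rw [h0, PowerSeries.order_zero] at hn
      exact ENat.top_ne_natCast _ hn
    have hmem : ((i : ℝ), (n : ℝ)) ∈ convexHull ℝ (orderPoints H) :=
      subset_convexHull ℝ _ ⟨i, n, hn, rfl⟩
    rcases lt_trichotomy x i with hi | hi | hi
    · have h1 := hmax i (Finset.mem_filter.2 ⟨Polynomial.mem_support_iff.2 hiH, hi⟩)
      simp only [slope, hordi] at h1 ⊢
      rw [div_le_iff₀ (by linarith)] at h1
      linarith
    · have := h.2 _ hmem hi.symm
      simp only at this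
      rw [hi]
      linarith
    -- The segment from a point on the left to the point of index `k` meets the vertical line at `x`
    -- at height at least `y`.
    · have hmemk : ((k : ℝ), (ord k : ℝ)) ∈ convexHull ℝ (orderPoints H) :=
        subset_convexHull ℝ _ ⟨k, ord k, (PowerSeries.coe_toNat_order hkH).symm, rfl⟩
      have hki : (0 : ℝ) < k - i := by linarith
      have hseg := (convex_convexHull ℝ (orderPoints H)) hmem hmemk
        (a := (k - x) / (k - i)) (b := (x - i) / (k - i)) (div_nonneg (by linarith) hki.le)
        (div_nonneg (by linarith) hki.le) (by field_simp; ring)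
      have h1 := h.2 _ hseg (by
        simp only [Prod.smul_mk, Prod.mk_add_mk, smul_eq_mul]
        field_simp
        ring)
      simp only [Prod.smul_mk, Prod.mk_add_mk, smul_eq_mul] at h1
      have h2 : (k - x) / (k - i) * n + (x - i) / (k - i) * ord k =
        ((k - x) * n + (x - i) * ord k) / ((k : ℝ) - i) := by ring
      rw [h2, le_div_iff₀ hki] at h1
      have h3 : slope k * (x - i) ≤ n - y := by
        simp only [slope]
        rw [div_mul_eq_mul_div, div_le_iff₀ (by linarith)]
        linarith
      linarith

lemma coeff_boundaryPoly (H : L⟦X⟧[X]) (i j : ℕ)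
    [Decidable (((i : ℝ), (j : ℝ)) ∈ newtonPolygon H)] :
    PowerSeries.coeff j ((boundaryPoly H).coeff i) =
      if ((i : ℝ), (j : ℝ)) ∈ newtonPolygon H then PowerSeries.coeff j (H.coeff i) else 0 := by
  unfold boundaryPoly
  simp only [Polynomial.finsetSum_coeff, Polynomial.coeff_monomial]
  rw [Finset.sum_ite_eq' H.support i]
  split_ifs with h1 h2 h2
  · rw [PowerSeries.coeff_mk, if_pos h2]
  · rw [PowerSeries.coeff_mk, if_neg h2]
  · rw [Polynomial.notMem_support_iff.1 h1]
  · simp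

lemma IsWeierstrass.natDegree_boundaryPoly {H : L⟦X⟧[X]} (hH : IsWeierstrass H) :
    (boundaryPoly H).natDegree = H.natDegree := by
  classical
  refine le_antisymm ?_ ?_
  · rw [Polynomial.natDegree_le_iff_coeff_eq_zero]
    intro i hi
    ext j
    rw [coeff_boundaryPoly, Polynomial.coeff_eq_zero_of_natDegree_lt hi]
    simp
  · apply Polynomial.le_natDegree_of_ne_zero
    intro h
    have h1 := coeff_boundaryPoly H H.natDegree 0
    rw [h, Nat.cast_zero, if_pos hH.top_mem_newtonPolygon, hH.monic.coeff_natDegree] at h1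
    simp at h1

lemma quasiHom_natDegree_le (q m : ℕ) (P : L[X]) :
    (quasiHom q m P).natDegree ≤ q * P.natDegree := by
  refine Polynomial.natDegree_sum_le_of_forall_le _ _ fun i hi => ?_
  refine (Polynomial.natDegree_monomial_le _).trans (Nat.mul_le_mul_left _ ?_)
  exact Nat.lt_succ_iff.1 (Finset.mem_range.1 hi)

lemma quasiHom_coeff_mul {q : ℕ} (hq : q ≠ 0) (m : ℕ) (P : L[X]) {i : ℕ} (hi : i ≤ P.natDegree) :
    (quasiHom q m P).coeff (q * i) =
      PowerSeries.monomial (m * (P.natDegree - i)) (P.coeff i) := by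
  unfold quasiHom
  rw [Polynomial.finsetSum_coeff, Finset.sum_eq_single i]
  · rw [Polynomial.coeff_monomial, if_pos rfl]
  · intro j _ hj
    rw [Polynomial.coeff_monomial, if_neg]
    intro h
    exact hj (Nat.eq_of_mul_eq_mul_left (Nat.pos_of_ne_zero hq) h)
  · intro h
    exact absurd (Finset.mem_range.2 (Nat.lt_succ_of_le hi)) h

lemma quasiHom_coeff_top {q : ℕ} (hq : q ≠ 0) (m : ℕ) {P : L[X]} (hP : P.Monic) :
    (quasiHom q m P).coeff (q * P.natDegree) = 1 := by
  rw [quasiHom_coeff_mul hq m P le_rfl, hP.coeff_natDegree]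
  simp

lemma quasiHom_monic {q : ℕ} (hq : q ≠ 0) (m : ℕ) {P : L[X]} (hP : P.Monic) :
    (quasiHom q m P).Monic :=
  Polynomial.monic_of_natDegree_le_of_coeff_eq_one _ (quasiHom_natDegree_le q m P)
    (quasiHom_coeff_top hq m hP)

lemma quasiHom_natDegree {q : ℕ} (hq : q ≠ 0) (m : ℕ) {P : L[X]} (hP : P.Monic) :
    (quasiHom q m P).natDegree = q * P.natDegree :=
  le_antisymm (quasiHom_natDegree_le q m P)
    (Polynomial.le_natDegree_of_ne_zero (by rw [quasiHom_coeff_top hq m hP]; simp))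

/-- Read on the boundary polynomial, which has the degree of `H`. It later makes `q` and `deg P`
divisors of `deg F`. -/
lemma EdgeData.IsEdgeDataOf.natDegree_eq {D : EdgeData L} {H : L⟦X⟧[X]}
    (hD : D.IsEdgeDataOf H) (hH : IsWeierstrass H) :
    H.natDegree = D.N * (D.q * D.P.natDegree) := by
  obtain ⟨c, hc, h⟩ := hD.boundary_eq
  have hQ := quasiHom_monic D.q_ne_zero D.m hD.monic
  rw [← hH.natDegree_boundaryPoly, h, Polynomial.natDegree_C_mul (by simpa using hc),
    hQ.natDegree_pow, quasiHom_natDegree D.q_ne_zero D.m hD.monic]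

/-- For `m = 0` the boundary polynomial would take the value `c P(0)^N ≠ 0` at the origin, where a
Weierstrass polynomial vanishes. -/
lemma EdgeData.IsEdgeDataOf.m_pos {D : EdgeData L} {H : L⟦X⟧[X]}
    (hD : D.IsEdgeDataOf H) (hH : IsWeierstrass H) : 0 < D.m := by
  classical
  by_contra hm
  have hm0 : D.m = 0 := by omega
  obtain ⟨c, hc, h⟩ := hD.boundary_eq
  have h1 : origin L (quasiHom D.q D.m D.P) = D.P.coeff 0 := by
    have := quasiHom_coeff_mul D.q_ne_zero D.m D.P (Nat.zero_le _)
    rw [mul_zero] at this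
    rw [origin_apply, this, hm0, zero_mul, ← PowerSeries.coeff_zero_eq_constantCoeff_apply,
      PowerSeries.coeff_monomial_same]
  have h2 := congrArg (origin L) h
  rw [map_mul, map_pow, h1, origin_C, origin_apply, ← PowerSeries.coeff_zero_eq_constantCoeff_apply,
    coeff_boundaryPoly, PowerSeries.coeff_zero_eq_constantCoeff_apply,
    hH.coeff_zero 0 hH.degree_pos] at h2
  simp only [ite_self, PowerSeries.constantCoeff_C] at h2
  exact mul_ne_zero hc (pow_ne_zero _ hD.coeff_zero_ne) h2.symm

/-- All terms of `H` lie on or above a line of negative slope, and every non-constant term of `W`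
moves them strictly upwards. -/
lemma coeff_coeff_mul (H W : L⟦X⟧[X]) {r c : ℝ} (hr : 0 < r)
    (hH : ∀ i n : ℕ, PowerSeries.coeff n (H.coeff i) ≠ 0 → c ≤ n + r * i) {i j : ℕ}
    (hij : j + r * i ≤ c) :
    PowerSeries.coeff j ((H * W).coeff i) = PowerSeries.coeff j (H.coeff i) * origin L W := by
  rw [Polynomial.coeff_mul, map_sum, Finset.sum_eq_single (i, 0)]
  · rw [PowerSeries.coeff_mul, Finset.sum_eq_single (j, 0)]
    · rw [origin_apply, PowerSeries.coeff_zero_eq_constantCoeff_apply]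
    · rintro ⟨j1, j2⟩ hj hne
      rw [Finset.HasAntidiagonal.mem_antidiagonal] at hj
      simp only at hj ⊢
      rw [mul_eq_zero]
      left
      by_contra h0
      have h1 := hH _ _ h0
      have h2 : (j : ℝ) = j1 + j2 := by exact_mod_cast hj.symm
      have h3 : (j2 : ℝ) ≤ 0 := by linarith
      have h4 : j2 = 0 := by exact_mod_cast le_antisymm h3 (Nat.cast_nonneg _)
      subst h4
      exact hne (by simp at hj ⊢; exact hj)
    · intro h; simp at h
  · rintro ⟨i1, i2⟩ hi hne
    rw [Finset.HasAntidiagonal.mem_antidiagonal] at hi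
    simp only at hi ⊢
    rw [PowerSeries.coeff_mul]
    refine Finset.sum_eq_zero ?_
    rintro ⟨j1, j2⟩ hj
    rw [Finset.HasAntidiagonal.mem_antidiagonal] at hj
    simp only at hj ⊢
    rw [mul_eq_zero]
    left
    by_contra h0
    have h1 := hH _ _ h0
    have h2 : (j : ℝ) = j1 + j2 := by exact_mod_cast hj.symm
    have h3 : (i : ℝ) = i1 + i2 := by exact_mod_cast hi.symm
    have h5 : (0 : ℝ) ≤ j2 := Nat.cast_nonneg _
    have h6 : (i2 : ℝ) ≤ 0 := by
      have : r * i2 ≤ 0 := by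
        rw [h3, mul_add] at hij
        linarith
      exact nonpos_of_mul_nonpos_right this hr
    have h4 : i2 = 0 := by exact_mod_cast le_antisymm h6 (Nat.cast_nonneg _)
    subst h4
    exact hne (by simp at hi ⊢; exact hi)
  · intro h; simp at h

/-- Among the terms with least `a i`, the one with least `i` is not cancelled, and `x^v` divides the
sum. -/
lemma le_of_eq_sum_lead {H W : L⟦X⟧[X]} {v : ℕ} {I : Finset ℕ} {A : ℕ → L⟦X⟧[X]} {a : ℕ → ℕ}
    {α : ℕ → L} (hA : ∀ i ∈ I, HasLead (A i) (a i) i (α i)) (hα : ∀ i ∈ I, α i ≠ 0)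
    (hsum : Polynomial.C (PowerSeries.X ^ v) * H * W = ∑ i ∈ I, A i) {i : ℕ} (hi : i ∈ I) :
    v ≤ a i := by
  classical
  obtain ⟨k, hk, hmin⟩ := Finset.exists_min_image I a ⟨i, hi⟩
  refine le_trans ?_ (hmin i hi)
  obtain ⟨l, hl, hlmin⟩ := Finset.exists_min_image (I.filter fun i => a i = a k) id
    ⟨k, Finset.mem_filter.2 ⟨hk, rfl⟩⟩
  rw [Finset.mem_filter] at hl
  by_contra hlt
  push Not at hlt
  apply hα l hl.1
  have h1 := congrArg (fun p : L⟦X⟧[X] => PowerSeries.coeff (a k) (p.coeff l)) hsum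
  simp only [Polynomial.finsetSum_coeff, map_sum] at h1
  rw [mul_assoc, Polynomial.coeff_C_mul, PowerSeries.coeff_X_pow_mul', if_neg (not_le.2 hlt),
    Finset.sum_eq_single l] at h1
  · rw [h1, ← hl.2, (hA l hl.1).coeff_coeff]
  · intro b hb hbl
    apply (hA b hb).coeff_coeff_eq_zero
    rcases (hmin b hb).eq_or_lt with h | h
    · right
      exact lt_of_le_of_ne (hlmin b (Finset.mem_filter.2 ⟨hb, h.symm⟩)) hbl.symm
    · exact Or.inl h
  · intro h; exact absurd hl.1 h

/-- The terms of a Weierstrass polynomial `H` on its Newton polygon, read off from an expression of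
the product of `H`, a power of `x` and a unit `W` as a sum of terms `x^(a i) y^i Uᵢ`. -/
lemma coeff_eq_of_eq_sum_lead {H W : L⟦X⟧[X]} (hH : IsWeierstrass H) {v : ℕ} {I : Finset ℕ}
    {A : ℕ → L⟦X⟧[X]} {a : ℕ → ℕ}
    {α : ℕ → L} (hA : ∀ i ∈ I, HasLead (A i) (a i) i (α i)) (hα : ∀ i ∈ I, α i ≠ 0)
    (hsum : Polynomial.C (PowerSeries.X ^ v) * H * W = ∑ i ∈ I, A i) {i j : ℕ}
    (hij : ((i : ℝ), (j : ℝ)) ∈ newtonPolygon H) :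
    PowerSeries.coeff j (H.coeff i) * origin L W = if i ∈ I ∧ a i = v + j then α i else 0 := by
  classical
  obtain ⟨r, hr, hs⟩ := hH.exists_slope hij
  have hv : ∀ i ∈ I, v ≤ a i := fun i hi => le_of_eq_sum_lead hA hα hsum hi
  have hprod : ∀ i' j' : ℕ, (j' : ℝ) + r * i' ≤ j + r * i →
      PowerSeries.coeff j' (H.coeff i') * origin L W =
        ∑ b ∈ I, PowerSeries.coeff (v + j') ((A b).coeff i') := by
    intro i' j' h
    rw [← coeff_coeff_mul H W hr hs h]
    have h1 := congrArg (fun p : L⟦X⟧[X] => PowerSeries.coeff (v + j') (p.coeff i')) hsum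
    simp only [Polynomial.finsetSum_coeff, map_sum] at h1
    rw [← h1, mul_assoc, Polynomial.coeff_C_mul, PowerSeries.coeff_X_pow_mul',
      if_pos (Nat.le_add_right _ _), Nat.add_sub_cancel_left]
  -- Take `k` minimising `a b + r b`. A term able to cancel `x^(a k) y^k` would have both exponents
  -- at most `a k` and `k`, contradicting minimality; so this monomial survives and cannot lie below
  -- the supporting line.
  have hge : ∀ b ∈ I, (v : ℝ) + j + r * i ≤ a b + r * b := by
    intro b hb
    obtain ⟨k, hk, hmin⟩ := Finset.exists_min_image I (fun b => (a b : ℝ) + r * b) ⟨b, hb⟩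
    refine le_trans ?_ (hmin b hb)
    by_contra hlt
    push Not at hlt
    obtain ⟨j', hj'⟩ := Nat.exists_eq_add_of_le (hv k hk)
    have hj'' : (a k : ℝ) = v + j' := by exact_mod_cast hj'
    have h1 := hprod k j' (by linarith)
    rw [Finset.sum_eq_single k, ← hj', (hA k hk).coeff_coeff] at h1
    · have h2 : PowerSeries.coeff j' (H.coeff k) = 0 := by
        by_contra h0
        have := hs _ _ h0
        linarith
      rw [h2, zero_mul] at h1
      exact hα k hk h1.symm
    · intro c hc hck
      rw [← hj']
      apply (hA c hc).coeff_coeff_eq_zero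
      by_contra hcon
      push Not at hcon
      have h3 := hmin c hc
      have h4 : (a c : ℝ) ≤ a k := by exact_mod_cast hcon.1
      have h5 : (k : ℝ) ≤ c := le_of_mul_le_mul_left (by linarith) hr
      exact hck (le_antisymm hcon.2 (by exact_mod_cast h5))
    · intro h; exact absurd hk h
  rw [hprod i j le_rfl]
  have hother : ∀ b ∈ I, b ≠ i → PowerSeries.coeff (v + j) ((A b).coeff i) = 0 := by
    intro c hc hci
    apply (hA c hc).coeff_coeff_eq_zero
    by_contra hcon
    push Not at hcon
    have h3 := hge c hc
    have h4 : (a c : ℝ) ≤ v + j := by exact_mod_cast hcon.1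
    have h5 : (i : ℝ) ≤ c := le_of_mul_le_mul_left (by linarith) hr
    exact hci (le_antisymm hcon.2 (by exact_mod_cast h5))
  by_cases hi : i ∈ I
  · rw [Finset.sum_eq_single i hother (fun h => absurd hi h)]
    split_ifs with h
    · rw [← h.2, (hA i hi).coeff_coeff]
    · apply (hA i hi).coeff_coeff_eq_zero
      left
      have h1 := hge i hi
      have h2 : v + j ≤ a i := by exact_mod_cast (show (v : ℝ) + j ≤ a i by linarith)
      exact lt_of_le_of_ne h2 fun h3 => h ⟨hi, h3.symm⟩
  · rw [if_neg fun h => hi h.1]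
    exact Finset.sum_eq_zero fun b hb => hother b hb fun h => hi (h ▸ hb)

end NewtonPolygon

/-! ### The pull-back `σ` and quasi-homogeneous sums in `z`. -/

namespace EdgeData

variable {L : Type u} [Field L] (D : EdgeData L)

lemma substX_X (t : ℕ) :
    D.substX t PowerSeries.X = PowerSeries.C (D.z ^ t) * PowerSeries.X ^ D.q := by
  simp only [substX, RingHom.comp_apply, PowerSeries.map_X, PowerSeries.rescale_X, RingHom.coe_coe,
    map_mul, PowerSeries.expand_X, PowerSeries.expand_C]

lemma coeff_substX (t : ℕ) (a : L⟦X⟧) (n : ℕ) :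
    PowerSeries.coeff n (D.substX t a) = if D.q ∣ n then
      D.z ^ (t * (n / D.q)) * AdjoinRoot.of D.P (PowerSeries.coeff (n / D.q) a) else 0 := by
  simp only [substX, RingHom.comp_apply, RingHom.coe_coe, PowerSeries.coeff_expand,
    PowerSeries.coeff_rescale, PowerSeries.coeff_map, pow_mul]

@[simp] lemma constantCoeff_substX (t : ℕ) (a : L⟦X⟧) :
    PowerSeries.constantCoeff (D.substX t a) = AdjoinRoot.of D.P (PowerSeries.constantCoeff a) := by
  rw [← PowerSeries.coeff_zero_eq_constantCoeff_apply, coeff_substX, if_pos (dvd_zero _),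
    Nat.zero_div, mul_zero, pow_zero, one_mul, PowerSeries.coeff_zero_eq_constantCoeff_apply]

@[simp] lemma sigma_C (s t : ℕ) (c : D.Ext⟦X⟧) (a : L⟦X⟧) :
    D.sigma s t c (Polynomial.C a) = Polynomial.C (D.substX t a) := by
  simp [sigma]

@[simp] lemma sigma_X (s t : ℕ) (c : D.Ext⟦X⟧) :
    D.sigma s t c Polynomial.X = Polynomial.C (PowerSeries.X ^ D.m) *
      (Polynomial.X + Polynomial.C (PowerSeries.C (D.z ^ s) + c)) := by
  simp [sigma]

lemma sigma_eq_shift (s t : ℕ) (c : D.Ext⟦X⟧) (G : L⟦X⟧[X]) :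
    D.sigma s t c G = shift c (D.sigma s t 0 G) := by
  have : D.sigma s t c = (shift c).comp (D.sigma s t 0) := by
    apply Polynomial.ringHom_ext
    · intro a; simp
    · simp only [sigma_X, RingHom.comp_apply, map_mul, map_add, shift_C, shift_X,
        add_zero]
      ring
  rw [this, RingHom.comp_apply]

/-- As `m > 0`, both coordinates of `σ` vanish at `x = 0`. -/
lemma residue_sigma (hm : 0 < D.m) (s t : ℕ) (c : D.Ext⟦X⟧) (G : L⟦X⟧[X]) :
    residue D.Ext (D.sigma s t c G) = Polynomial.C (AdjoinRoot.of D.P (origin L G)) := by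
  have : (residue D.Ext).comp (D.sigma s t c) =
      (Polynomial.C.comp (AdjoinRoot.of D.P)).comp (origin L) := by
    apply Polynomial.ringHom_ext
    · intro a; simp
    · simp [hm.ne', origin_eq]
  exact congrArg (fun f : L⟦X⟧[X] →+* D.Ext[X] => f G) this

lemma origin_sigma (hm : 0 < D.m) (s t : ℕ) (c : D.Ext⟦X⟧) (G : L⟦X⟧[X]) :
    origin D.Ext (D.sigma s t c G) = AdjoinRoot.of D.P (origin L G) := by
  rw [origin_eq, residue_sigma D hm, Polynomial.coeff_C_zero]

/-- The pull-back of `x^a y^i U`. -/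
lemma sigma_lead (hm : 0 < D.m) (s t : ℕ) {c : D.Ext⟦X⟧}
    (hc : PowerSeries.constantCoeff c = 0) {G : L⟦X⟧[X]} {a i : ℕ} {α : L} (h : HasLead G a i α) :
    ∃ R, D.sigma s t c G = Polynomial.C (PowerSeries.X ^ (D.q * a + D.m * i)) * R ∧
      residue D.Ext R = Polynomial.C (AdjoinRoot.of D.P α * D.z ^ (t * a)) *
        (Polynomial.X + Polynomial.C (D.z ^ s)) ^ i := by
  obtain ⟨U, rfl, rfl⟩ := h
  refine ⟨Polynomial.C (PowerSeries.C (D.z ^ (t * a))) *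
    (Polynomial.X + Polynomial.C (PowerSeries.C (D.z ^ s) + c)) ^ i * D.sigma s t c U, ?_, ?_⟩
  · rw [map_mul, map_mul, sigma_C, map_pow (D.substX t), substX_X, map_pow (D.sigma s t c),
      sigma_X, mul_pow, mul_pow, ← map_pow PowerSeries.C, ← pow_mul, ← pow_mul, ← Polynomial.C_pow,
      ← pow_mul, pow_add, Polynomial.C_mul, Polynomial.C_mul]
    ring
  · simp only [map_mul, map_pow, map_add, residue_C, residue_X, residue_sigma D hm,
      PowerSeries.constantCoeff_C, hc, map_zero, add_zero]
    ring

lemma hasLead_sigma (hm : 0 < D.m) (s t : ℕ) {c : D.Ext⟦X⟧}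
    (hc : PowerSeries.constantCoeff c = 0) {G : L⟦X⟧[X]} {a i : ℕ} {α : L} (h : HasLead G a i α) :
    HasLead (D.sigma s t c G) (D.q * a + D.m * i) 0
      (AdjoinRoot.of D.P α * D.z ^ (t * a + s * i)) := by
  obtain ⟨R, hR, hr⟩ := D.sigma_lead hm s t hc h
  refine ⟨R, by rw [hR, pow_zero, mul_one], ?_⟩
  rw [origin_eq, hr, Polynomial.coeff_zero_eq_eval_zero]
  simp [pow_add, pow_mul, mul_assoc]

variable {D}

lemma z_ne_zero (h : D.P.coeff 0 ≠ 0) : D.z ≠ 0 := by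
  intro hz
  have h1 : Polynomial.aeval D.z D.P = 0 := by
    rw [Polynomial.aeval_def, AdjoinRoot.algebraMap_eq]
    exact AdjoinRoot.eval₂_root D.P
  rw [hz, ← Polynomial.coeff_zero_eq_aeval_zero', AdjoinRoot.algebraMap_eq] at h1
  exact h ((map_eq_zero_iff _ (AdjoinRoot.of D.P).injective).1 h1)

lemma aeval_z_eq_zero_iff (Q : L[X]) : Polynomial.aeval D.z Q = 0 ↔ D.P ∣ Q := by
  rw [z, AdjoinRoot.aeval_eq, AdjoinRoot.mk_eq_zero]

/-- The Bézout relation makes the exponent of `z` an affine function of `i` once the weight `w` is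
fixed; distinct `i` thus give distinct powers. -/
lemma exponent_eq {q m s t u i w : ℕ} (hst : q * s = t * m + 1) (h : q * u + m * i = w) :
    q * (t * u + s * i) = t * w + i := by
  subst h
  linear_combination i * hst

section Quasihomogeneous

variable {s t w : ℕ} {I : Finset ℕ} {u : ℕ → ℕ} {β : ℕ → L}

/-- The polynomial `Q` with `∑ βᵢ z^(t uᵢ + s i) = z^E Q(z)`, where `q uᵢ + m i = w` and
`E = ⌈t w / q⌉`. -/
def quasiPoly (D : EdgeData L) (s t w : ℕ) (I : Finset ℕ) (u : ℕ → ℕ) (β : ℕ → L) : L[X] :=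
  ∑ i ∈ I, Polynomial.C (β i) *
    Polynomial.X ^ (t * u i + s * i - (t * w + D.q - 1) / D.q)

variable (hst : D.q * s = t * D.m + 1) (hu : ∀ i ∈ I, D.q * u i + D.m * i = w)
include hst hu

/-- With `E = ⌈t w / q⌉` one has `q (t u + s i - E) = i - (q E - t w)`. In particular the natural
subtraction in `quasiPoly` is a true one. -/
lemma exponent_spec {i : ℕ} (hi : i ∈ I) :
    (t * w + D.q - 1) / D.q ≤ t * u i + s * i ∧
    D.q * (t * u i + s * i - (t * w + D.q - 1) / D.q) ≤ i := by
  have hq : 0 < D.q := Nat.pos_of_ne_zero D.q_ne_zero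
  have h := exponent_eq hst (hu i hi)
  have h1 : (t * w + D.q - 1) / D.q ≤ t * u i + s * i := by
    apply Nat.le_of_lt_succ
    rw [Nat.div_lt_iff_lt_mul hq, Nat.succ_mul, mul_comm (t * u i + s * i), h]
    omega
  refine ⟨h1, ?_⟩
  rw [Nat.mul_sub, h]
  have h2 := Nat.div_add_mod (t * w + D.q - 1) D.q
  have h3 := Nat.mod_lt (t * w + D.q - 1) hq
  omega

lemma aeval_quasiPoly : D.z ^ ((t * w + D.q - 1) / D.q) *
    Polynomial.aeval D.z (D.quasiPoly s t w I u β) =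
    ∑ i ∈ I, AdjoinRoot.of D.P (β i) * D.z ^ (t * u i + s * i) := by
  rw [quasiPoly, map_sum, Finset.mul_sum]
  refine Finset.sum_congr rfl fun i hi => ?_
  have h := (exponent_spec hst hu hi).1
  rw [map_mul, map_pow, Polynomial.aeval_X, Polynomial.aeval_C, AdjoinRoot.algebraMap_eq,
    mul_left_comm, ← pow_add, Nat.add_sub_cancel' h]

lemma coeff_quasiPoly {i : ℕ} (hi : i ∈ I) :
    (D.quasiPoly s t w I u β).coeff (t * u i + s * i - (t * w + D.q - 1) / D.q) = β i := by
  rw [quasiPoly, Polynomial.finsetSum_coeff, Finset.sum_eq_single i]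
  · simp
  · intro j hj hji
    rw [Polynomial.coeff_C_mul_X_pow, if_neg]
    intro h
    have h1 := (exponent_spec hst hu hi).1
    have h2 := (exponent_spec hst hu hj).1
    have h3 : t * u i + s * i = t * u j + s * j := by omega
    have h4 := exponent_eq hst (hu i hi)
    have h5 := exponent_eq hst (hu j hj)
    rw [h3, h5] at h4
    omega
  · exact fun h => absurd hi h

lemma natDegree_quasiPoly_le {d : ℕ} (hd : ∀ i ∈ I, i < D.q * (d + 1)) :
    (D.quasiPoly s t w I u β).natDegree ≤ d := by
  refine Polynomial.natDegree_sum_le_of_forall_le _ _ fun i hi => ?_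
  refine (Polynomial.natDegree_C_mul_X_pow_le _ _).trans ?_
  have h := (exponent_spec hst hu hi).2.trans_lt (hd i hi)
  exact Nat.lt_succ_iff.1 (lt_of_mul_lt_mul_left h (Nat.zero_le _))

/-- The polynomial `quasiPoly` is divisible by `P` and has smaller degree, so it is zero, and the `β
i` are its coefficients. -/
lemma eq_zero_of_quasi_sum_eq_zero (hz : D.z ≠ 0) (hI : ∀ i ∈ I, i < D.q * D.P.natDegree)
    (h0 : ∑ i ∈ I, AdjoinRoot.of D.P (β i) * D.z ^ (t * u i + s * i) = 0) :
    ∀ i ∈ I, β i = 0 := by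
  rw [← aeval_quasiPoly hst hu, mul_eq_zero, or_iff_right (pow_ne_zero _ hz),
    aeval_z_eq_zero_iff] at h0
  have hl := D.irreducible.natDegree_pos
  have hd := natDegree_quasiPoly_le (β := β) hst hu (d := D.P.natDegree - 1)
    (by rwa [Nat.sub_add_cancel hl])
  have hQ := Polynomial.eq_zero_of_dvd_of_natDegree_lt h0 (by omega)
  intro i hi
  rw [← coeff_quasiPoly (β := β) hst hu hi, hQ, Polynomial.coeff_zero]

/-- Now `i = q deg P` is allowed, and `quasiPoly` is a non-zero constant multiple of `P`. Modulo the
vanishing sum, the sum weighted by `i` is `q z^(E+1) Q'(z)`, and `P` does not divide `P'` because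
`deg P` is non-zero in `L`. -/
lemma derivative_quasi_sum_ne_zero (hz : D.z ≠ 0) (hq : (D.q : L) ≠ 0)
    (hl : (D.P.natDegree : L) ≠ 0) (hI : ∀ i ∈ I, i ≤ D.q * D.P.natDegree)
    (hβ : ∃ i ∈ I, β i ≠ 0)
    (h0 : ∑ i ∈ I, AdjoinRoot.of D.P (β i) * D.z ^ (t * u i + s * i) = 0) :
    ∑ i ∈ I, (i : D.Ext) * (AdjoinRoot.of D.P (β i) * D.z ^ (t * u i + s * i)) ≠ 0 := by
  set E := (t * w + D.q - 1) / D.q with hE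
  set Q := D.quasiPoly s t w I u β with hQdef
  have hqpos : 0 < D.q := Nat.pos_of_ne_zero D.q_ne_zero
  have hdvd : D.P ∣ Q := by
    have h := h0
    rwa [← aeval_quasiPoly hst hu, mul_eq_zero, or_iff_right (pow_ne_zero _ hz),
      aeval_z_eq_zero_iff] at h
  have hQ0 : Q ≠ 0 := by
    obtain ⟨i, hi, hne⟩ := hβ
    intro h
    rw [← coeff_quasiPoly (β := β) hst hu hi, ← hQdef, h, Polynomial.coeff_zero] at hne
    exact hne rfl
  have hdeg : Q.natDegree ≤ D.P.natDegree := natDegree_quasiPoly_le hst hu fun i hi => by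
    have := hI i hi
    rw [mul_add, mul_one]
    omega
  have hder : Polynomial.aeval D.z (Polynomial.derivative Q) ≠ 0 := by
    rw [Ne, aeval_z_eq_zero_iff]
    have hPd : ¬ D.P ∣ Polynomial.derivative D.P := by
      intro hd
      have hpos := D.irreducible.natDegree_pos
      have h1 := Polynomial.eq_zero_of_dvd_of_natDegree_lt hd
        (Polynomial.natDegree_derivative_lt hpos.ne')
      have h2 := Polynomial.coeff_derivative D.P (D.P.natDegree - 1)
      rw [h1, Nat.sub_add_cancel hpos, Polynomial.coeff_zero, Nat.cast_sub hpos, Nat.cast_one,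
        sub_add_cancel] at h2
      rcases mul_eq_zero.1 h2.symm with h3 | h3
      · exact D.irreducible.ne_zero (Polynomial.leadingCoeff_eq_zero.1 h3)
      · exact hl h3
    obtain ⟨A, hA⟩ := hdvd
    have hA0 : A ≠ 0 := by rintro rfl; exact hQ0 (by rw [hA, mul_zero])
    have hAdeg : A.natDegree = 0 := by
      rw [hA, Polynomial.natDegree_mul D.irreducible.ne_zero hA0] at hdeg
      omega
    rw [Polynomial.eq_C_of_natDegree_eq_zero hAdeg] at hA hA0
    have ha : A.coeff 0 ≠ 0 := by simpa using hA0
    rw [hA, mul_comm, Polynomial.derivative_C_mul]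
    rwa [Polynomial.dvd_C_mul ha]
  have hsum : ∑ i ∈ I, (i : D.Ext) * (AdjoinRoot.of D.P (β i) * D.z ^ (t * u i + s * i)) =
      (D.q : D.Ext) * (D.z ^ (E + 1) * Polynomial.aeval D.z (Polynomial.derivative Q)) := by
    have h1 : D.z ^ (E + 1) * Polynomial.aeval D.z (Polynomial.derivative Q) =
        ∑ i ∈ I, ((t * u i + s * i - E : ℕ) : D.Ext) *
          (AdjoinRoot.of D.P (β i) * D.z ^ (t * u i + s * i)) := by
      rw [hQdef, quasiPoly, Polynomial.derivative_sum, map_sum, Finset.mul_sum]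
      refine Finset.sum_congr rfl fun i hi => ?_
      have h := (exponent_spec hst hu hi).1
      rw [← hE] at h ⊢
      obtain ⟨n, hn⟩ := Nat.exists_eq_add_of_le h
      rw [hn, Nat.add_sub_cancel_left, Polynomial.derivative_C_mul_X_pow]
      rcases n with _ | n
      · simp
      · simp only [map_mul, map_pow, Polynomial.aeval_X, Polynomial.aeval_C,
          AdjoinRoot.algebraMap_eq, Nat.add_sub_cancel, map_natCast]
        ring
    -- Here `i` is `q` times the exponent in `Q` plus the constant `q E - t w`, whose contribution
    -- vanishes by `h0`.
    have h2 : ∀ i ∈ I, (i : D.Ext) * (AdjoinRoot.of D.P (β i) * D.z ^ (t * u i + s * i)) =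
        (D.q : D.Ext) * (((t * u i + s * i - E : ℕ) : D.Ext) *
          (AdjoinRoot.of D.P (β i) * D.z ^ (t * u i + s * i))) +
        ((D.q : D.Ext) * E - t * w) * (AdjoinRoot.of D.P (β i) * D.z ^ (t * u i + s * i)) := by
      intro i hi
      have h := (exponent_spec hst hu hi).1
      have h3 : (D.q : D.Ext) * ((t * u i + s * i : ℕ) : D.Ext) = t * w + i := by
        exact_mod_cast congrArg (Nat.cast (R := D.Ext)) (exponent_eq hst (hu i hi))
      rw [Nat.cast_sub h]
      linear_combination (-(AdjoinRoot.of D.P (β i) * D.z ^ (t * u i + s * i))) * h3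
    rw [Finset.sum_congr rfl h2, Finset.sum_add_distrib, ← Finset.mul_sum, ← Finset.mul_sum, h0,
      mul_zero, add_zero, h1]
  rw [hsum]
  refine mul_ne_zero ?_ (mul_ne_zero (pow_ne_zero _ hz) hder)
  rw [← map_natCast (AdjoinRoot.of D.P)]
  exact (map_ne_zero_iff _ (AdjoinRoot.of D.P).injective).2 hq

end Quasihomogeneous

end EdgeData

/-! ### Pull-back of an expansion and its leading sum. -/

section Expansions

variable {K L : Type u} [Field K] [Field L] [Algebra K L] {ι : Type*} [Fintype ι]

/-- The weight `n e + ∑ bⱼ vⱼ` of an exponent `(n, b)`. -/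
def weight (e : ℕ) (v : ι → ℕ) (B : ℕ × (ι → ℕ)) : ℕ := B.1 * e + ∑ j, B.2 j * v j

/-- The monomial `μ^n ∏ λⱼ^bⱼ`. -/
def leadMonomial (μ : L) (lam : ι → L) (B : ℕ × (ι → ℕ)) : L := μ ^ B.1 * ∏ j, lam j ^ B.2 j

variable (K) in
/-- The monomials of a given weight, with exponents in `E`, are linearly independent over `K`. -/
def IndepOn (e : ℕ) (μ : L) (v : ι → ℕ) (lam : ι → L) (E : Set (ι → ℕ)) : Prop :=
  ∀ (w : ℕ) (T : Finset (ℕ × (ι → ℕ))) (f : ℕ × (ι → ℕ) → K),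
    (∀ B ∈ T, B.2 ∈ E ∧ weight e v B = w) →
    ∑ B ∈ T, algebraMap K L (f B) * leadMonomial μ lam B = 0 → ∀ B ∈ T, f B = 0

/-- The exponents of weight `w` that occur in a family of power series. -/
def exponents (e : ℕ) (v : ι → ℕ) (c : (ι → ℕ) →₀ K⟦X⟧) (w : ℕ) : Finset (ℕ × (ι → ℕ)) :=
  (Finset.range (w + 1) ×ˢ c.support).filter fun B => weight e v B = w

/-- The combination of the monomials of weight `w` in a family of power series. -/
def leadSum (e : ℕ) (μ : L) (v : ι → ℕ) (lam : ι → L) (c : (ι → ℕ) →₀ K⟦X⟧) (w : ℕ) : L :=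
  ∑ B ∈ exponents e v c w,
    algebraMap K L (PowerSeries.coeff B.1 (c B.2)) * leadMonomial μ lam B

variable {pull : K⟦X⟧[X] →+* L⟦X⟧[X]} {e : ℕ} {μ : L}
  (hx : HasLead (pull (Polynomial.C PowerSeries.X)) e 0 μ)
  (hu : ∀ a, origin L (pull (Polynomial.C a)) = algebraMap K L (PowerSeries.constantCoeff a))
include hx hu

lemma hasLead_pull_C {a : K⟦X⟧} {n : ℕ} (ha : ∀ m < n, PowerSeries.coeff m a = 0) :
    HasLead (pull (Polynomial.C a)) (n * e) 0
      (algebraMap K L (PowerSeries.coeff n a) * μ ^ n) := by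
  obtain ⟨b, rfl⟩ := PowerSeries.X_pow_dvd_iff.2 ha
  have h1 : HasLead (pull (Polynomial.C b)) 0 0 (algebraMap K L (PowerSeries.constantCoeff b)) :=
    ⟨pull (Polynomial.C b), by simp, hu b⟩
  have h2 := (hx.pow n).mul h1
  rw [← map_pow, ← map_mul, ← Polynomial.C_pow, ← Polynomial.C_mul] at h2
  rw [PowerSeries.coeff_X_pow_mul', if_pos le_rfl, Nat.sub_self,
    PowerSeries.coeff_zero_eq_constantCoeff_apply, mul_comm (algebraMap K L _)]
  simpa only [add_zero, mul_zero] using h2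

variable (he : 0 < e) {ψ : ι → K⟦X⟧[X]} {v ε : ι → ℕ} {lam : ι → L}
  (hψ : ∀ j, HasLead (pull (ψ j)) (v j) (ε j) (lam j))
include he hψ

/-- The leading term of the pull-back of a combination of monomials in `x` and the `ψⱼ`. -/
lemma hasLead_pull_sum {c : (ι → ℕ) →₀ K⟦X⟧} {i w : ℕ}
    (hi : ∀ b ∈ c.support, ∑ j, b j * ε j = i)
    (hw : ∀ n b, PowerSeries.coeff n (c b) ≠ 0 → w ≤ weight e v (n, b)) :
    HasLead (pull (c.sum fun b a => Polynomial.C a * ∏ j, ψ j ^ b j)) w i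
      (leadSum e μ v lam c w) := by
  have hsum : leadSum e μ v lam c w = ∑ b ∈ c.support, ∑ n ∈ Finset.range (w + 1),
      if weight e v (n, b) = w then algebraMap K L (PowerSeries.coeff n (c b)) *
        leadMonomial μ lam (n, b) else 0 := by
    rw [leadSum, exponents, Finset.sum_filter, Finset.sum_product_right]
  rw [hsum, Finsupp.sum, map_sum]
  refine HasLead.sum _ fun b hb => ?_
  rw [map_mul, map_prod]
  have hprod : HasLead (∏ j, pull (ψ j ^ b j)) (∑ j, b j * v j) i (∏ j, lam j ^ b j) := by
    rw [← hi b hb]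
    refine HasLead.prod _ fun j _ => ?_
    rw [map_pow]
    exact (hψ j).pow (b j)
  by_cases hn : ∃ n, weight e v (n, b) = w
  · obtain ⟨n, hn⟩ := hn
    have huniq : ∀ m, weight e v (m, b) = w → m = n := by
      intro m hm
      rw [← hn] at hm
      simp only [weight, Nat.add_right_cancel_iff] at hm
      exact Nat.eq_of_mul_eq_mul_right he hm
    rw [Finset.sum_eq_single n]
    · rw [if_pos hn]
      have h1 := (hasLead_pull_C hx hu (a := c b) (n := n) fun m hm => by
        by_contra h0
        have h2 := hw m b h0
        rw [← hn] at h2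
        simp only [weight, add_le_add_iff_right] at h2
        exact absurd (le_of_mul_le_mul_right h2 he) (not_le.2 hm)).mul hprod
      rw [mul_assoc, zero_add] at h1
      rw [← hn]
      exact h1
    · intro m _ hm
      rw [if_neg fun h => hm (huniq m h)]
    -- Since `e > 0`, the exponent `n` of `x` is at most the weight `w`.
    · intro h
      exfalso
      apply h
      rw [Finset.mem_range, Nat.lt_succ_iff, ← hn]
      exact (Nat.le_mul_of_pos_right n he).trans (Nat.le_add_right _ _)
  -- No power of `x` brings `b` to the weight `w`: the whole term has larger weight and contributes
  -- zero.
  · push Not at hn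
    rw [Finset.sum_eq_zero fun n _ => if_neg (hn n)]
    have h0 : c b ≠ 0 := Finsupp.mem_support_iff.1 hb
    have h1 := (hasLead_pull_C hx hu (a := c b) (n := (c b).order.toNat) fun m hm =>
      PowerSeries.coeff_of_lt_order_toNat m hm).mul hprod
    rw [zero_add] at h1
    exact h1.weaken (lt_of_le_of_ne (hw _ b (PowerSeries.coeff_order h0)) (hn _).symm)

-- Take for `w` the least weight that occurs: the coefficients of weight `w` are not all zero, so by
-- independence neither is their combination.
omit hx hu he hψ in
lemma exists_leadSum_ne_zero (he : 0 < e) {c : (ι → ℕ) →₀ K⟦X⟧} {E : Set (ι → ℕ)}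
    (hE : IndepOn K e μ v lam E) (hc : ∀ b ∈ c.support, b ∈ E) (h0 : c ≠ 0) :
    ∃ w, (∀ n b, PowerSeries.coeff n (c b) ≠ 0 → w ≤ weight e v (n, b)) ∧
      (∃ n b, PowerSeries.coeff n (c b) ≠ 0 ∧ weight e v (n, b) = w) ∧
      leadSum e μ v lam c w ≠ 0 := by
  classical
  have hex : ∃ w n b, PowerSeries.coeff n (c b) ≠ 0 ∧ weight e v (n, b) = w := by
    obtain ⟨b, hb⟩ := Finsupp.support_nonempty_iff.2 h0
    exact ⟨_, _, b, PowerSeries.coeff_order (Finsupp.mem_support_iff.1 hb), rfl⟩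
  refine ⟨Nat.find hex, fun n b h => Nat.find_min' hex ⟨n, b, h, rfl⟩, Nat.find_spec hex,
    fun hs => ?_⟩
  obtain ⟨n, b, hne, hw⟩ := Nat.find_spec hex
  have hmem : (n, b) ∈ exponents e v c (Nat.find hex) := by
    rw [exponents, Finset.mem_filter, Finset.mem_product, Finset.mem_range, Nat.lt_succ_iff]
    refine ⟨⟨?_, ?_⟩, hw⟩
    · rw [← hw]
      exact (Nat.le_mul_of_pos_right n he).trans (Nat.le_add_right _ _)
    · rw [Finsupp.mem_support_iff]
      rintro h
      simp only [h, map_zero, ne_eq, not_true_eq_false] at hne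
  refine hne (hE (Nat.find hex) _ (fun B => PowerSeries.coeff B.1 (c B.2)) (fun B hB => ?_) hs _
    hmem)
  rw [exponents, Finset.mem_filter, Finset.mem_product] at hB
  exact ⟨hc _ hB.1.2, hB.2⟩

end Expansions

/-! ### Linear independence of the leading monomials. -/

section Independence

variable {K L : Type u} [Field K] [Field L] [Algebra K L] {k : ℕ} {e : ℕ} {μ : L}

lemma weight_castSucc (v : Fin (k + 1) → ℕ) (B : ℕ × (Fin (k + 1) → ℕ)) :
    weight e v B = weight e (fun j : Fin k => v j.castSucc) (B.1, fun j : Fin k => B.2 j.castSucc) +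
      B.2 (Fin.last k) * v (Fin.last k) := by
  simp only [weight, Fin.sum_univ_castSucc, add_assoc]

lemma leadMonomial_castSucc (lam : Fin (k + 1) → L) (B : ℕ × (Fin (k + 1) → ℕ)) :
    leadMonomial μ lam B =
      leadMonomial μ (fun j : Fin k => lam j.castSucc) (B.1, fun j : Fin k => B.2 j.castSucc) *
      lam (Fin.last k) ^ B.2 (Fin.last k) := by
  simp only [leadMonomial, Fin.prod_univ_castSucc, mul_assoc]

/-- With a fixed last exponent `i`, all monomials share the factor `lam_last^i` and all weights
shift by the same amount. -/
lemma IndepOn.of_last {v : Fin (k + 1) → ℕ} {lam : Fin (k + 1) → L} {E : Set (Fin k → ℕ)}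
    (h : IndepOn K e μ (fun j => v j.castSucc) (fun j => lam j.castSucc) E)
    (hlam : lam (Fin.last k) ≠ 0) (i : ℕ) :
    IndepOn K e μ v lam {b | (fun j : Fin k => b j.castSucc) ∈ E ∧ b (Fin.last k) = i} := by
  classical
  intro w T f hT hsum
  let φ : ℕ × (Fin (k + 1) → ℕ) → ℕ × (Fin k → ℕ) :=
    fun B => (B.1, fun j : Fin k => B.2 j.castSucc)
  let g : ℕ × (Fin k → ℕ) → ℕ × (Fin (k + 1) → ℕ) :=
    fun B => (B.1, Fin.snoc (α := fun _ => ℕ) B.2 i)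
  have hg : ∀ B ∈ T, g (φ B) = B := by
    intro B hB
    refine Prod.ext rfl (funext fun j => ?_)
    refine Fin.lastCases ?_ (fun j => ?_) j
    · simp only [g, Fin.snoc_last]; exact (hT B hB).1.2.symm
    · simp only [g, φ, Fin.snoc_castSucc]
  have hinj : Set.InjOn φ T := fun B hB B' hB' hBB => by rw [← hg B hB, ← hg B' hB', hBB]
  have key := h (w - i * v (Fin.last k)) (T.image φ) (fun B => f (g B)) (by
    intro B' hB'
    obtain ⟨B, hB, rfl⟩ := Finset.mem_image.1 hB'
    obtain ⟨⟨h1, h2⟩, h3⟩ := hT B hB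
    refine ⟨h1, ?_⟩
    rw [weight_castSucc, h2] at h3
    exact Nat.eq_sub_of_add_eq h3) (by
    rw [Finset.sum_image hinj]
    have h1 : (∑ B ∈ T, algebraMap K L (f (g (φ B))) *
        leadMonomial μ (fun j : Fin k => lam j.castSucc) (φ B)) * lam (Fin.last k) ^ i = 0 := by
      rw [← hsum, Finset.sum_mul]
      refine Finset.sum_congr rfl fun B hB => ?_
      rw [hg B hB, leadMonomial_castSucc, (hT B hB).1.2, mul_assoc]
    exact (mul_eq_zero.1 h1).resolve_right (pow_ne_zero _ hlam))
  intro B hB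
  have := key _ (Finset.mem_image_of_mem φ hB)
  rwa [hg B hB] at this

variable {D : EdgeData L} {s t : ℕ}

/-- Weights and leading coefficients change under `σ` as prescribed by `hasLead_sigma`. -/
lemma IndepOn.sigma (hst : D.q * s = t * D.m + 1) (hz : D.z ≠ 0) {v : Fin (k + 1) → ℕ}
    {lam : Fin (k + 1) → L} {E : Set (Fin (k + 1) → ℕ)}
    (h : ∀ i, IndepOn K e μ v lam {b | b ∈ E ∧ b (Fin.last k) = i}) :
    IndepOn (L := D.Ext) K (D.q * e) (AdjoinRoot.of D.P μ * D.z ^ (t * e))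
      (fun j => D.q * v j + D.m * if j = Fin.last k then 1 else 0)
      (fun j => AdjoinRoot.of D.P (lam j) * D.z ^ (t * v j + s * if j = Fin.last k then 1 else 0))
      {b | b ∈ E ∧ b (Fin.last k) < D.q * D.P.natDegree} := by
  classical
  intro w T f hT hsum
  have hwt : ∀ B : ℕ × (Fin (k + 1) → ℕ), weight (D.q * e)
      (fun j => D.q * v j + D.m * if j = Fin.last k then 1 else 0) B =
      D.q * weight e v B + D.m * B.2 (Fin.last k) := by
    intro B
    simp only [weight, mul_add, Finset.sum_add_distrib, Finset.mul_sum]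
    simp only [mul_ite, mul_one, mul_zero, Finset.sum_ite_eq', Finset.mem_univ, if_true]
    rw [mul_left_comm, mul_comm D.m, add_assoc]
    congr 2
    exact Finset.sum_congr rfl fun j _ => mul_left_comm _ _ _
  have hmon : ∀ B : ℕ × (Fin (k + 1) → ℕ), leadMonomial (AdjoinRoot.of D.P μ * D.z ^ (t * e))
      (fun j => AdjoinRoot.of D.P (lam j) * D.z ^ (t * v j + s * if j = Fin.last k then 1 else 0)) B
      = AdjoinRoot.of D.P (leadMonomial μ lam B) *
        D.z ^ (t * weight e v B + s * B.2 (Fin.last k)) := by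
    intro B
    simp only [leadMonomial, mul_pow, Finset.prod_mul_distrib, map_mul, map_prod, map_pow,
      ← pow_mul, Finset.prod_pow_eq_pow_sum, weight]
    have : ∑ j, (t * v j + s * if j = Fin.last k then 1 else 0) * B.2 j =
        t * (∑ j, B.2 j * v j) + s * B.2 (Fin.last k) := by
      simp only [add_mul, Finset.sum_add_distrib, Finset.mul_sum]
      simp only [mul_ite, mul_one, mul_zero, ite_mul, zero_mul, Finset.sum_ite_eq',
        Finset.mem_univ, if_true]
      congr 1
      exact Finset.sum_congr rfl fun j _ => by ring
    rw [this]
    ring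
  -- Terms are grouped by last exponent `i`. Group `i` has the common old weight `u i` and the
  -- common factor `z^(t u i + s i)`, so the groups vanish separately; the hypothesis `h` then
  -- applies within each one.
  let I : Finset ℕ := T.image fun B => B.2 (Fin.last k)
  let u : ℕ → ℕ := fun i => (w - D.m * i) / D.q
  let β : ℕ → L := fun i => ∑ B ∈ T with B.2 (Fin.last k) = i,
    algebraMap K L (f B) * leadMonomial μ lam B
  have hw : ∀ B ∈ T, D.q * weight e v B + D.m * B.2 (Fin.last k) = w := fun B hB => by
    rw [← hwt, (hT B hB).2]
  have huB : ∀ B ∈ T, u (B.2 (Fin.last k)) = weight e v B := by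
    intro B hB
    simp only [u]
    rw [← hw B hB, Nat.add_sub_cancel, Nat.mul_div_cancel_left _ (Nat.pos_of_ne_zero D.q_ne_zero)]
  have hβ : ∀ i ∈ I, β i = 0 := by
    refine EdgeData.eq_zero_of_quasi_sum_eq_zero (w := w) (u := u) hst ?_ hz ?_ ?_
    · intro i hi
      obtain ⟨B, hB, rfl⟩ := Finset.mem_image.1 hi
      rw [huB B hB, hw B hB]
    · intro i hi
      obtain ⟨B, hB, rfl⟩ := Finset.mem_image.1 hi
      exact (hT B hB).1.2
    · rw [← hsum, ← Finset.sum_fiberwise_of_maps_to (s := T) (t := I)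
        (g := fun B => B.2 (Fin.last k))
        (fun B hB => Finset.mem_image_of_mem (fun B => B.2 (Fin.last k)) hB)]
      refine Finset.sum_congr rfl fun i hi => ?_
      simp only [β]
      rw [map_sum, Finset.sum_mul]
      refine Finset.sum_congr rfl fun B hB => ?_
      obtain ⟨hBT, rfl⟩ := Finset.mem_filter.1 hB
      rw [huB B hBT, hmon, map_mul, AdjoinRoot.algebraMap_eq', RingHom.comp_apply, mul_assoc]
  intro B hB
  refine h (B.2 (Fin.last k)) (weight e v B) (T.filter fun B' => B'.2 (Fin.last k) =
    B.2 (Fin.last k)) f (fun B' hB' => ?_) (hβ _ (Finset.mem_image_of_mem _ hB)) B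
    (Finset.mem_filter.2 ⟨hB, rfl⟩)
  obtain ⟨hBT, hBl⟩ := Finset.mem_filter.1 hB'
  exact ⟨⟨(hT B' hBT).1.1, hBl⟩, by rw [← huB B' hBT, hBl, huB B hB]⟩

end Independence

/-! ### Spanning families and degrees of minimal polynomials. -/

section Span

/-- By way of `f`, the ring `B` is spanned by `n` elements as a module over `A`. -/
def SpannedBy {A B : Type u} [CommRing A] [CommRing B] (f : A →+* B) (n : ℕ) : Prop :=
  ∃ (ι : Type) (_ : Fintype ι) (g : ι → B), Fintype.card ι = n ∧
    ∀ y, ∃ c : ι → A, y = ∑ i, f (c i) * g i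

variable {A B C : Type u} [CommRing A] [CommRing B] [CommRing C]

lemma SpannedBy.id : SpannedBy (RingHom.id A) 1 :=
  ⟨Unit, inferInstance, fun _ => 1, rfl, fun y => ⟨fun _ => y, by simp⟩⟩

lemma SpannedBy.comp {g : B →+* C} {f : A →+* B} {m n : ℕ} (hg : SpannedBy g m)
    (hf : SpannedBy f n) : SpannedBy (g.comp f) (n * m) := by
  obtain ⟨ι, _, b, hb, hb'⟩ := hf
  obtain ⟨κ, _, c, hc, hc'⟩ := hg
  refine ⟨ι × κ, inferInstance, fun p => g (b p.1) * c p.2, by simp [hb, hc], fun y => ?_⟩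
  obtain ⟨y', rfl⟩ := hc' y
  choose a ha using fun i => hb' (y' i)
  refine ⟨fun p => a p.2 p.1, ?_⟩
  rw [Fintype.sum_prod_type_right]
  refine Finset.sum_congr rfl fun i _ => ?_
  rw [ha i, map_sum, Finset.sum_mul]
  exact Finset.sum_congr rfl fun j _ => by rw [map_mul, RingHom.comp_apply]; ring

/-- Finite and torsion-free over a principal ideal domain, `B` is free of rank at most `n`. By
Cayley–Hamilton, the characteristic polynomial of multiplication by `y` annihilates `y`. -/
lemma SpannedBy.natDegree_minpoly_le [IsDomain A] [IsPrincipalIdealRing A] [IsDomain B]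
    [Algebra A B] {n : ℕ} (h : SpannedBy (algebraMap A B) n)
    (hinj : Function.Injective (algebraMap A B)) (y : B) :
    IsIntegral A y ∧ (minpoly A y).natDegree ≤ n := by
  obtain ⟨ι, _, g, hn, hg⟩ := h
  have hspan : Submodule.span A (Set.range g) = ⊤ := by
    rw [eq_top_iff]
    rintro y -
    obtain ⟨c, rfl⟩ := hg y
    refine Submodule.sum_mem _ fun i _ => ?_
    rw [← Algebra.smul_def]
    exact Submodule.smul_mem _ _ (Submodule.subset_span ⟨i, rfl⟩)
  have hfin : Module.Finite A B := ⟨⟨(Set.finite_range g).toFinset, by simpa using hspan⟩⟩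
  have hfaith : FaithfulSMul A B := (faithfulSMul_iff_algebraMap_injective A B).2 hinj
  have htf : Module.IsTorsionFree A B := .trans_faithfulSMul A B B
  have hfree : Module.Free A B := inferInstance
  have hrank : Module.finrank A B ≤ n := by
    have := finrank_range_le_card (R := A) (b := g)
    rw [Set.finrank, hspan, finrank_top, hn] at this
    exact this
  refine ⟨Algebra.IsIntegral.isIntegral y, ?_⟩
  let M := Algebra.lmul A B y
  have h1 : Polynomial.aeval y M.charpoly = 0 := by
    have h2 := LinearMap.aeval_self_charpoly M
    have h3 : Polynomial.aeval M M.charpoly = Algebra.lmul A B (Polynomial.aeval y M.charpoly) :=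
      Polynomial.aeval_algHom_apply (Algebra.lmul A B) y _
    rw [h2] at h3
    have h4 := congrArg (fun f : B →ₗ[A] B => f 1) h3
    simpa using h4.symm
  have h2 := minpoly.min A y (LinearMap.charpoly_monic M) h1
  rw [← LinearMap.charpoly_natDegree M] at hrank
  exact (Polynomial.natDegree_le_natDegree h2).trans hrank

end Span

/-- Sort the exponents of `x` by residue modulo `q`: the `x^r b_j` with `r < q` and `b_j` in a basis
of `L[Z]/P` span. -/
lemma EdgeData.spannedBy_substX {L : Type u} [Field L] {D : EdgeData L} (hP : D.P.Monic)
    (hz : D.z ≠ 0) (t : ℕ) : SpannedBy (D.substX t) (D.q * D.P.natDegree) := by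
  have hq : 0 < D.q := Nat.pos_of_ne_zero D.q_ne_zero
  let b : Module.Basis (Fin D.P.natDegree) L D.Ext := AdjoinRoot.powerBasisAux' hP
  refine ⟨Fin D.q × Fin D.P.natDegree, inferInstance,
    fun p => PowerSeries.X ^ (p.1 : ℕ) * PowerSeries.C (b p.2), by simp, fun y => ?_⟩
  -- The inverse power of `z` compensates the factor `z^(t n)` that the substitution attaches to
  -- `x^(q n)`.
  refine ⟨fun p => PowerSeries.mk fun n =>
    b.repr ((D.z ^ (t * n))⁻¹ * PowerSeries.coeff (D.q * n + p.1) y) p.2, ?_⟩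
  ext n
  rw [map_sum, Fintype.sum_prod_type]
  have hterm : ∀ (r : Fin D.q) (a : L⟦X⟧) (β : D.Ext), PowerSeries.coeff n
      (D.substX t a * (PowerSeries.X ^ (r : ℕ) * PowerSeries.C β)) =
      if n % D.q = r then D.z ^ (t * (n / D.q)) *
        AdjoinRoot.of D.P (PowerSeries.coeff (n / D.q) a) * β else 0 := by
    intro r a β
    rw [mul_left_comm, PowerSeries.coeff_X_pow_mul', PowerSeries.coeff_mul_C, coeff_substX]
    have hnr := Nat.div_add_mod n D.q
    by_cases hr : n % D.q = r
    · have hle : (r : ℕ) ≤ n := hr ▸ Nat.mod_le n D.q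
      have hsub : n - r = D.q * (n / D.q) := by omega
      rw [if_pos hr, if_pos hle, hsub, if_pos (dvd_mul_right _ _), Nat.mul_div_cancel_left _ hq]
    · rw [if_neg hr]
      split_ifs with h1 h2
      · exfalso
        obtain ⟨j, hj⟩ := h2
        apply hr
        have : n = r + D.q * j := by omega
        rw [this, Nat.add_mul_mod_self_left, Nat.mod_eq_of_lt r.2]
      · rw [zero_mul]
      · rfl
  simp only [hterm]
  rw [Finset.sum_eq_single (⟨n % D.q, Nat.mod_lt n hq⟩ : Fin D.q)]
  · simp only [if_true, PowerSeries.coeff_mk, Nat.div_add_mod]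
    have h1 := b.sum_repr ((D.z ^ (t * (n / D.q)))⁻¹ * PowerSeries.coeff n y)
    have h2 : PowerSeries.coeff n y = D.z ^ (t * (n / D.q)) *
        ((D.z ^ (t * (n / D.q)))⁻¹ * PowerSeries.coeff n y) :=
      (mul_inv_cancel_left₀ (pow_ne_zero _ hz) _).symm
    conv_lhs => rw [h2, ← h1]
    rw [Finset.mul_sum]
    refine Finset.sum_congr rfl fun i _ => ?_
    rw [Algebra.smul_def, AdjoinRoot.algebraMap_eq, mul_assoc]
  · intro r _ hr
    refine Finset.sum_eq_zero fun i _ => if_neg fun h => hr (Fin.ext h.symm)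
  · intro h; exact absurd (Finset.mem_univ _) h

/-! ### Splitting an expansion by the exponent of `φ_k`. -/

section Pieces

variable {K : Type u} [Field K] {k : ℕ}

/-- The part of a family of exponents with a given last entry. -/
def lastPart (c : (Fin (k + 1) → ℕ) →₀ K⟦X⟧) (i : ℕ) : (Fin (k + 1) → ℕ) →₀ K⟦X⟧ :=
  c.filter fun b => b (Fin.last k) = i

/-- The last entries of the exponents of a family. -/
def lastEntries (c : (Fin (k + 1) → ℕ) →₀ K⟦X⟧) : Finset ℕ :=
  c.support.image fun b => b (Fin.last k)

lemma mem_support_lastPart {c : (Fin (k + 1) → ℕ) →₀ K⟦X⟧} {i : ℕ} {b : Fin (k + 1) → ℕ} :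
    b ∈ (lastPart c i).support ↔ b ∈ c.support ∧ b (Fin.last k) = i := by
  rw [lastPart, Finsupp.support_filter, Finset.mem_filter]

lemma lastPart_apply {c : (Fin (k + 1) → ℕ) →₀ K⟦X⟧} {i : ℕ} {b : Fin (k + 1) → ℕ}
    (h : b (Fin.last k) = i) : lastPart c i b = c b :=
  Finsupp.filter_apply_pos _ _ h

lemma lastPart_ne_zero {c : (Fin (k + 1) → ℕ) →₀ K⟦X⟧} {i : ℕ} :
    lastPart c i ≠ 0 ↔ i ∈ lastEntries c := by
  rw [← Finsupp.support_nonempty_iff, lastEntries, Finset.mem_image]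
  exact ⟨fun ⟨b, hb⟩ => ⟨b, (mem_support_lastPart.1 hb).1, (mem_support_lastPart.1 hb).2⟩,
    fun ⟨b, hb, h⟩ => ⟨b, mem_support_lastPart.2 ⟨hb, h⟩⟩⟩

lemma sum_lastPart {M : Type*} [AddCommMonoid M] (c : (Fin (k + 1) → ℕ) →₀ K⟦X⟧)
    (g : (Fin (k + 1) → ℕ) → K⟦X⟧ → M) :
    c.sum g = ∑ i ∈ lastEntries c, (lastPart c i).sum g := by
  rw [Finsupp.sum, ← Finset.sum_fiberwise_of_maps_to (s := c.support) (t := lastEntries c)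
    (g := fun b => b (Fin.last k)) fun b hb => Finset.mem_image_of_mem _ hb]
  refine Finset.sum_congr rfl fun i _ => ?_
  rw [lastPart, Finsupp.sum_filter_index, Finsupp.support_filter]

end Pieces

/-! ### The invariants at one rank, and the polynomial `φ_k`. -/

namespace Stage

variable {K : Type u} [Field K]

/-- The situation at some rank, `φ_k` being left aside. -/
structure IsChain (S : Stage K) (d : Fin (S.k + 1) → ℕ) (e : ℕ) (μ : S.L) (v : Fin S.k → ℕ)
    (lam : Fin S.k → S.L) : Prop where
  d_zero : d 0 = 1
  d_succ : ∀ i : Fin S.k, d i.succ = S.bound i * d i.castSucc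
  bound_pos : ∀ i, 0 < S.bound i
  phi_monic : ∀ j, (S.phi j).Monic
  phi_natDegree : ∀ j, (S.phi j).natDegree = d j.castSucc
  pull_C : ∀ a, S.pull (Polynomial.C a) = Polynomial.C (S.paramX a)
  origin_pull_C : ∀ a, origin S.L (S.pull (Polynomial.C a)) =
    algebraMap K S.L (PowerSeries.constantCoeff a)
  spanned : SpannedBy S.paramX (d (Fin.last S.k))
  e_pos : 0 < e
  mu_ne_zero : μ ≠ 0
  lead_X : HasLead (S.pull (Polynomial.C PowerSeries.X)) e 0 μ
  lead_phi : ∀ j, HasLead (S.pull (S.phi j)) (v j) 0 (lam j)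
  lam_ne_zero : ∀ j, lam j ≠ 0
  indep : IndepOn K e μ v lam {b | ∀ i, b i < S.bound i}

/-- The family `φ_0, …, φ_k`. -/
def psi (S : Stage K) : Fin (S.k + 1) → K⟦X⟧[X] :=
  Fin.snoc (α := fun _ => K⟦X⟧[X]) S.phi S.minPoly

/-- The situation at some rank. -/
structure IsFullChain (S : Stage K) (d : Fin (S.k + 1) → ℕ) (e : ℕ) (μ : S.L)
    (v : Fin (S.k + 1) → ℕ) (lam : Fin (S.k + 1) → S.L) : Prop where
  chain : S.IsChain d e μ (fun j => v j.castSucc) (fun j => lam j.castSucc)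
  psi_monic : ∀ j, (S.psi j).Monic
  psi_natDegree : ∀ j, (S.psi j).natDegree = d j
  lead_psi : ∀ j, HasLead (S.pull (S.psi j)) (v j) (if j = Fin.last S.k then 1 else 0) (lam j)
  lam_ne_zero : ∀ j, lam j ≠ 0

lemma natDegree_prod_pow {R ι : Type*} [CommRing R] [Nontrivial R] [Fintype ι] {ψ : ι → R[X]}
    (h : ∀ j, (ψ j).Monic) (b : ι → ℕ) :
    (∏ j, ψ j ^ b j).natDegree = ∑ j, b j * (ψ j).natDegree := by
  rw [Polynomial.natDegree_prod_of_monic _ _ fun j _ => (h j).pow _]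
  exact Finset.sum_congr rfl fun j _ => (h j).natDegree_pow _

lemma monic_prod_pow {R ι : Type*} [CommRing R] [Fintype ι] {ψ : ι → R[X]}
    (h : ∀ j, (ψ j).Monic) (b : ι → ℕ) : (∏ j, ψ j ^ b j).Monic :=
  Polynomial.monic_prod_of_monic _ _ fun j _ => (h j).pow _

namespace IsChain

variable {S : Stage K} {d : Fin (S.k + 1) → ℕ} {e : ℕ} {μ : S.L} {v : Fin S.k → ℕ}
  {lam : Fin S.k → S.L} (h : S.IsChain d e μ v lam)
include h

lemma d_last_pos : 0 < d (Fin.last S.k) := by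
  rw [radix_last h.d_zero h.d_succ]
  exact Finset.prod_pos fun i _ => h.bound_pos i

/-- The pull-back of a polynomial of small degree is a unit up to a power of `x`. -/
lemma exists_lead {G : K⟦X⟧[X]} (hG : G ≠ 0) (hdeg : G.degree < d (Fin.last S.k)) :
    ∃ w α, α ≠ 0 ∧ HasLead (S.pull G) w 0 α := by
  obtain ⟨c, hc, rfl⟩ := exists_sum_monic (p := fun b : Fin S.k → ℕ => ∏ j, S.phi j ^ b j)
    (monic_prod_pow h.phi_monic) {b | ∀ i, b i < S.bound i} (d (Fin.last S.k)) (fun n hn => by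
      obtain ⟨b, hb, hbn⟩ := radix_exists h.d_zero h.d_succ h.bound_pos n
      refine ⟨fun j => b j.castSucc, hb, ?_⟩
      rw [natDegree_prod_pow h.phi_monic, ← hbn, Fin.sum_univ_castSucc]
      simp only [h.phi_natDegree]
      rw [Fin.sum_univ_castSucc] at hbn
      -- A degree below the last place value leaves no room for the last digit.
      have h0 : b (Fin.last S.k) = 0 := by
        by_contra h0
        have := Nat.le_mul_of_pos_left (d (Fin.last S.k)) (Nat.pos_of_ne_zero h0)
        omega
      rw [h0, zero_mul, add_zero]) G hdeg
  have hc0 : c ≠ 0 := by rintro rfl; exact hG Finsupp.sum_zero_index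
  obtain ⟨w, hw, -, hne⟩ := exists_leadSum_ne_zero h.e_pos h.indep hc hc0
  exact ⟨w, _, hne, hasLead_pull_sum (ε := fun _ => 0) h.lead_X h.origin_pull_C h.e_pos h.lead_phi
    (by simp) hw⟩

lemma paramX_injective : Function.Injective S.paramX := by
  rw [injective_iff_map_eq_zero]
  intro a ha
  by_contra h0
  have h1 := hasLead_pull_C h.lead_X h.origin_pull_C (a := a) (n := a.order.toNat)
    fun m hm => PowerSeries.coeff_of_lt_order_toNat m hm
  refine h1.ne_zero (mul_ne_zero ?_ (pow_ne_zero _ h.mu_ne_zero)) ?_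
  · exact (map_ne_zero_iff _ (algebraMap K S.L).injective).2 (PowerSeries.coeff_order h0)
  · rw [h.pull_C, ha, Polynomial.C_0]

omit h in
lemma eval_pull (G : K⟦X⟧[X]) :
    (S.pull G).eval 0 = Polynomial.eval₂ S.paramX S.paramY G := by
  have : (Polynomial.evalRingHom 0).comp S.pull =
      Polynomial.eval₂RingHom S.paramX S.paramY := by
    apply Polynomial.ringHom_ext
    · intro a; simp [paramX]
    · simp [paramY]
  exact congrArg (fun f : K⟦X⟧[X] →+* S.L⟦X⟧ => f G) this

omit h in
lemma _root_.NewtonPuiseux.HasLead.eval_ne_zero {L : Type u} [Field L] {G : L⟦X⟧[X]} {a : ℕ}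
    {α : L} (h : HasLead G a 0 α) (hα : α ≠ 0) : G.eval 0 ≠ 0 := by
  rw [← Polynomial.coeff_zero_eq_eval_zero]
  intro h0
  have := h.coeff_coeff
  rw [h0, map_zero] at this
  exact hα this.symm

/-- The spanning family bounds the degree from above. A polynomial of smaller degree has by
`exists_lead` a pull-back that is non-zero at `y = 0`, hence does not vanish on the parametrisation.
-/
lemma minPoly_spec : S.minPoly.Monic ∧ S.minPoly.natDegree = d (Fin.last S.k) ∧
    (S.pull S.minPoly).eval 0 = 0 := by
  let _ : Algebra K⟦X⟧ S.L⟦X⟧ := S.paramX.toAlgebra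
  have hmin : S.minPoly = minpoly K⟦X⟧ S.paramY := rfl
  obtain ⟨hint, hle⟩ := SpannedBy.natDegree_minpoly_le (A := K⟦X⟧) (B := S.L⟦X⟧) h.spanned
    h.paramX_injective S.paramY
  have hmonic : S.minPoly.Monic := by rw [hmin]; exact minpoly.monic hint
  have heval : (S.pull S.minPoly).eval 0 = 0 := by
    rw [eval_pull, hmin]
    exact minpoly.aeval K⟦X⟧ S.paramY
  refine ⟨hmonic, le_antisymm hle ?_, heval⟩
  by_contra hlt
  push Not at hlt
  obtain ⟨w, α, hα, hl⟩ := h.exists_lead hmonic.ne_zero (by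
    rw [Polynomial.degree_eq_natDegree hmonic.ne_zero]
    exact_mod_cast hlt)
  exact hl.eval_ne_zero hα heval

/-- Passage to the full family, once the leading term of `φ_k` is known. -/
lemma full {a : ℕ} {α : S.L} (hα : α ≠ 0) (hl : HasLead (S.pull S.minPoly) a 1 α) :
    S.IsFullChain d e μ (Fin.snoc (α := fun _ => ℕ) v a) (Fin.snoc (α := fun _ => S.L) lam α) := by
  refine ⟨by simpa only [Fin.snoc_castSucc] using h, fun j => ?_, fun j => ?_, fun j => ?_,
    fun j => ?_⟩ <;> refine Fin.lastCases ?_ (fun j => ?_) j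
  · simpa only [psi, Fin.snoc_last] using h.minPoly_spec.1
  · simpa only [psi, Fin.snoc_castSucc] using h.phi_monic j
  · simpa only [psi, Fin.snoc_last] using h.minPoly_spec.2.1
  · simpa only [psi, Fin.snoc_castSucc] using h.phi_natDegree j
  · simpa only [psi, Fin.snoc_last, if_true] using hl
  · simpa only [psi, Fin.snoc_castSucc, (Fin.castSucc_lt_last j).ne, if_false] using h.lead_phi j
  · simpa only [Fin.snoc_last] using hα
  · simpa only [Fin.snoc_castSucc] using h.lam_ne_zero j

end IsChain

namespace IsFullChain

variable {S : Stage K} {d : Fin (S.k + 1) → ℕ} {e : ℕ} {μ : S.L} {v : Fin (S.k + 1) → ℕ}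
  {lam : Fin (S.k + 1) → S.L} (h : S.IsFullChain d e μ v lam)
include h

lemma natDegree_prod (b : Fin (S.k + 1) → ℕ) :
    (∏ j, S.psi j ^ b j).natDegree = ∑ j, b j * d j := by
  rw [natDegree_prod_pow h.psi_monic]
  simp only [h.psi_natDegree]

lemma injOn_natDegree : Set.InjOn (fun b : Fin (S.k + 1) → ℕ => (∏ j, S.psi j ^ b j).natDegree)
    {b | ∀ i : Fin S.k, b i.castSucc < S.bound i} := by
  simp only [h.natDegree_prod]
  exact radix_injOn h.chain.d_zero h.chain.d_succ

lemma exists_expansion (G : K⟦X⟧[X]) : ∃ c : (Fin (S.k + 1) → ℕ) →₀ K⟦X⟧,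
    (∀ b ∈ c.support, ∀ i : Fin S.k, b i.castSucc < S.bound i) ∧
    G = c.sum fun b a => Polynomial.C a * ∏ j, S.psi j ^ b j := by
  refine exists_sum_monic (p := fun b : Fin (S.k + 1) → ℕ => ∏ j, S.psi j ^ b j)
    (monic_prod_pow h.psi_monic) {b | ∀ i : Fin S.k, b i.castSucc < S.bound i}
    (G.natDegree + 1) (fun n _ => ?_) G ?_
  · simp only [h.natDegree_prod]
    exact radix_exists h.chain.d_zero h.chain.d_succ h.chain.bound_pos n
  · rw [Polynomial.degree_lt_iff_coeff_zero]
    exact fun m hm => Polynomial.coeff_eq_zero_of_natDegree_lt hm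

/-- The leading term of the part of an expansion with a given exponent of `φ_k`. -/
lemma exists_lead_lastPart {c : (Fin (S.k + 1) → ℕ) →₀ K⟦X⟧}
    (hc : ∀ b ∈ c.support, ∀ i : Fin S.k, b i.castSucc < S.bound i) {i : ℕ}
    (hi : i ∈ lastEntries c) :
    ∃ w, (∀ n b, PowerSeries.coeff n (lastPart c i b) ≠ 0 → w ≤ weight e v (n, b)) ∧
      (∃ n b, PowerSeries.coeff n (lastPart c i b) ≠ 0 ∧ weight e v (n, b) = w) ∧
      leadSum e μ v lam (lastPart c i) w ≠ 0 ∧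
      HasLead (S.pull ((lastPart c i).sum fun b a => Polynomial.C a * ∏ j, S.psi j ^ b j)) w i
        (leadSum e μ v lam (lastPart c i) w) := by
  obtain ⟨w, hw, hex, hne⟩ := exists_leadSum_ne_zero (c := lastPart c i) h.chain.e_pos
    (h.chain.indep.of_last (h.lam_ne_zero _) i)
    (fun b hb => ⟨hc b (mem_support_lastPart.1 hb).1, (mem_support_lastPart.1 hb).2⟩)
    (lastPart_ne_zero.2 hi)
  refine ⟨w, hw, hex, hne, ?_⟩
  exact hasLead_pull_sum h.chain.lead_X h.chain.origin_pull_C h.chain.e_pos h.lead_psi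
    (fun b hb => by simpa using (mem_support_lastPart.1 hb).2) hw

lemma last_le_of_natDegree_le {c : (Fin (S.k + 1) → ℕ) →₀ K⟦X⟧}
    (hc : ∀ b ∈ c.support, ∀ i : Fin S.k, b i.castSucc < S.bound i) {N : ℕ}
    (hN : (c.sum fun b a => Polynomial.C a * ∏ j, S.psi j ^ b j).natDegree ≤
      N * d (Fin.last S.k)) {b : Fin (S.k + 1) → ℕ} (hb : b ∈ c.support) :
    ∑ j, b j * d j ≤ N * d (Fin.last S.k) := by
  have h1 := natDegree_lt_of_sum_monic (p := fun b : Fin (S.k + 1) → ℕ => ∏ j, S.psi j ^ b j)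
    (monic_prod_pow h.psi_monic) h.injOn_natDegree hc (D := N * d (Fin.last S.k) + 1)
    (by
      rw [Polynomial.degree_lt_iff_coeff_zero]
      exact fun m hm => Polynomial.coeff_eq_zero_of_natDegree_lt (by omega)) hb
  rw [h.natDegree_prod] at h1
  omega

/-- The pull-back by `σ` of a polynomial of degree `≤ q ℓ deg φ_k` that vanishes on the
parametrisation of the next rank. -/
lemma exists_lead_sigma {D : EdgeData S.L} {s t : ℕ} {c : D.Ext⟦X⟧} (hm : 0 < D.m)
    (hst : D.q * s = t * D.m + 1) (hz : D.z ≠ 0) (hq : (D.q : S.L) ≠ 0)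
    (hl : (D.P.natDegree : S.L) ≠ 0) (hc0 : PowerSeries.constantCoeff c = 0) {G : K⟦X⟧[X]}
    (hG : G ≠ 0) (hdeg : G.natDegree ≤ D.q * D.P.natDegree * d (Fin.last S.k))
    (heval : (D.sigma s t c (S.pull G)).eval 0 = 0) :
    ∃ a α, α ≠ 0 ∧ HasLead (D.sigma s t c (S.pull G)) a 1 α := by
  classical
  obtain ⟨b, hb, hGb⟩ := h.exists_expansion G
  have hI : ∀ i ∈ lastEntries b, i ≤ D.q * D.P.natDegree := by
    intro i hi
    obtain ⟨B, hB, rfl⟩ := Finset.mem_image.1 hi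
    have h1 := h.last_le_of_natDegree_le hb (hGb ▸ hdeg) hB
    rw [Fin.sum_univ_castSucc] at h1
    exact Nat.le_of_mul_le_mul_right ((Nat.le_add_left _ _).trans h1) h.chain.d_last_pos
  have hex : ∀ i, ∃ w : ℕ, ∃ α : S.L, ∃ R : D.Ext⟦X⟧[X], i ∈ lastEntries b → (α ≠ 0 ∧
      D.sigma s t c (S.pull ((lastPart b i).sum fun b a => Polynomial.C a * ∏ j, S.psi j ^ b j)) =
        Polynomial.C (PowerSeries.X ^ (D.q * w + D.m * i)) * R ∧
      residue D.Ext R = Polynomial.C (AdjoinRoot.of D.P α * D.z ^ (t * w)) *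
        (Polynomial.X + Polynomial.C (D.z ^ s)) ^ i) := by
    intro i
    by_cases hi : i ∈ lastEntries b
    · obtain ⟨w, -, -, hne, hlead⟩ := h.exists_lead_lastPart hb hi
      obtain ⟨R, hR, hr⟩ := D.sigma_lead hm s t hc0 hlead
      exact ⟨w, _, R, fun _ => ⟨hne, hR, hr⟩⟩
    · exact ⟨0, 0, 0, fun h => absurd h hi⟩
  choose w α R hspec using hex
  have hne : (lastEntries b).Nonempty := by
    rw [lastEntries, Finset.image_nonempty, Finsupp.support_nonempty_iff]
    rintro rfl
    exact hG (by rw [hGb, Finsupp.sum_zero_index])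
  obtain ⟨i0, hi0, hmin⟩ := Finset.exists_min_image (lastEntries b)
    (fun i => D.q * w i + D.m * i) hne
  -- After division by `x^w0`, only the groups of least new weight survive modulo `x`.
  set w0 := D.q * w i0 + D.m * i0 with hw0
  let T := (lastEntries b).filter fun i => D.q * w i + D.m * i = w0
  let Q : D.Ext⟦X⟧[X] := ∑ i ∈ lastEntries b,
    Polynomial.C (PowerSeries.X ^ (D.q * w i + D.m * i - w0)) * R i
  have hpull : D.sigma s t c (S.pull G) = Polynomial.C (PowerSeries.X ^ w0) * Q := by
    rw [hGb, sum_lastPart, map_sum, map_sum, Finset.mul_sum]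
    refine Finset.sum_congr rfl fun i hi => ?_
    rw [(hspec i hi).2.1, ← mul_assoc, ← Polynomial.C_mul, ← pow_add,
      Nat.add_sub_cancel' (hmin i hi)]
  have hres : residue D.Ext Q = ∑ i ∈ T, Polynomial.C (AdjoinRoot.of D.P (α i) * D.z ^ (t * w i)) *
        (Polynomial.X + Polynomial.C (D.z ^ s)) ^ i := by
    rw [map_sum, Finset.sum_filter]
    refine Finset.sum_congr rfl fun i hi => ?_
    rw [map_mul, residue_C, (hspec i hi).2.2]
    split_ifs with h1
    · rw [h1, Nat.sub_self, pow_zero, map_one, Polynomial.C_1, one_mul]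
    · have h2 : D.q * w i + D.m * i - w0 ≠ 0 := by
        have := hmin i hi
        omega
      rw [map_pow, PowerSeries.constantCoeff_X, zero_pow h2, Polynomial.C_0, zero_mul]
  have hQ0 : Q.coeff 0 = 0 := by
    rw [hpull, Polynomial.eval_mul, Polynomial.eval_C,
      ← Polynomial.coeff_zero_eq_eval_zero] at heval
    exact (mul_eq_zero.1 heval).resolve_left (pow_ne_zero _ PowerSeries.X_ne_zero)
  obtain ⟨U, hU⟩ := Polynomial.X_dvd_iff.2 hQ0
  have horig : origin D.Ext U = (residue D.Ext Q).coeff 1 := by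
    rw [hU, map_mul, residue_X, Polynomial.coeff_X_mul, origin_eq]
  have hT : ∀ i ∈ T, D.q * w i + D.m * i = w0 := fun i hi => (Finset.mem_filter.1 hi).2
  have hzero : ∑ i ∈ T, AdjoinRoot.of D.P (α i) * D.z ^ (t * w i + s * i) = 0 := by
    have h1 := congrArg (fun p : D.Ext[X] => p.coeff 0) hres
    simp only [residue_coeff, hQ0, map_zero, Polynomial.finsetSum_coeff, Polynomial.coeff_C_mul,
      Polynomial.coeff_X_add_C_pow, Nat.sub_zero, Nat.choose_zero_right, Nat.cast_one,
      mul_one] at h1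
    rw [h1]
    exact Finset.sum_congr rfl fun i _ => by ring
  have hder := EdgeData.derivative_quasi_sum_ne_zero (β := α) (I := T) hst hT hz hq hl
    (fun i hi => hI i (Finset.mem_filter.1 hi).1)
    ⟨i0, Finset.mem_filter.2 ⟨hi0, rfl⟩, (hspec i0 hi0).1⟩ hzero
  refine ⟨w0, origin D.Ext U, ?_, U, by rw [hpull, hU, pow_one, mul_assoc], rfl⟩
  intro h0
  apply hder
  rw [horig, hres] at h0
  simp only [Polynomial.finsetSum_coeff, Polynomial.coeff_C_mul, Polynomial.coeff_X_add_C_pow,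
    Nat.choose_one_right] at h0
  -- The coefficient of `y` in `(y + z^s)^i` is `i z^(s (i-1))`; the factor `z^s` makes the sum that
  -- of `hder`.
  have h1 := congrArg (fun x => D.z ^ s * x) h0
  simp only [mul_zero, Finset.mul_sum] at h1
  rw [← h1]
  refine Finset.sum_congr rfl fun i _ => ?_
  rcases i with _ | i
  · simp
  · rw [Nat.add_sub_cancel]
    ring

end IsFullChain

end Stage

/-! ### Induction on the rank. -/

namespace Stage

variable {K : Type u} [Field K]

lemma isChain_init {F : K⟦X⟧[X]} :
    (Stage.init F).IsChain (fun _ => 1) 1 (1 : K) Fin.elim0 Fin.elim0 := by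
  have hparam : (Stage.init F).paramX = RingHom.id K⟦X⟧ := by
    ext1 a
    simp [paramX]
  refine ⟨rfl, fun i => i.elim0, fun i => i.elim0, fun i => i.elim0, fun i => i.elim0,
    fun a => ?_, fun a => ?_, ?_, one_pos, one_ne_zero, ?_, fun i => i.elim0, fun i => i.elim0, ?_⟩
  · rw [hparam]; exact shift_C _ _
  · change origin K (shift (center F) (Polynomial.C a)) = PowerSeries.constantCoeff a
    simp
  · rw [hparam]; exact SpannedBy.id
  · exact ⟨1, by simp, map_one _⟩
  -- At rank `0` the weight is the exponent of `x`, so there is a single monomial in each weight.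
  · intro w T f hT hsum B hB
    have huniq : ∀ B' ∈ T, B' = B := by
      intro B' hB'
      have h1 := (hT B' hB').2
      rw [← (hT B hB).2] at h1
      simp only [weight, mul_one, Finset.univ_eq_empty, Finset.sum_empty, add_zero] at h1
      exact Prod.ext h1 (funext fun j => j.elim0)
    rw [Finset.sum_eq_single B (fun B' hB' hne => absurd (huniq B' hB') hne)
      (fun h => absurd hB h)] at hsum
    simpa [leadMonomial] using hsum

/-- The polynomial `φ_0` is `y - c_0`, and its pull-back is exactly `y`. -/
lemma exists_isFullChain_init (F : K⟦X⟧[X]) :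
    ∃ v lam, (Stage.init F).IsFullChain (fun _ => 1) 1 (1 : K) v lam := by
  refine ⟨_, _, (isChain_init (F := F)).full (a := 0) (α := (1 : K)) one_ne_zero ?_⟩
  obtain ⟨hmonic, hdeg, heval⟩ := (isChain_init (F := F)).minPoly_spec
  have h1 : (Stage.init F).minPoly =
      Polynomial.X + Polynomial.C ((Stage.init F).minPoly.coeff 0) := by
    conv_lhs => rw [Polynomial.eq_X_add_C_of_natDegree_le_one hdeg.le]
    rw [show (1 : ℕ) = (Stage.init F).minPoly.natDegree from hdeg.symm, hmonic.coeff_natDegree]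
    simp
  set b := (Stage.init F).minPoly.coeff 0
  change (shift (center F) (Stage.init F).minPoly).eval 0 = 0 at heval
  change HasLead (shift (center F) (Stage.init F).minPoly) 0 1 1
  rw [h1, map_add, shift_X, shift_C] at heval ⊢
  simp only [Polynomial.eval_add, Polynomial.eval_X, Polynomial.eval_C, zero_add] at heval
  rw [add_assoc, ← Polynomial.C_add, heval]
  exact ⟨1, by simp, map_one _⟩

section Next

variable {S : Stage K} {d : Fin (S.k + 1) → ℕ} {e : ℕ} {μ : S.L} {v : Fin (S.k + 1) → ℕ}
  {lam : Fin (S.k + 1) → S.L} {D : EdgeData S.L} {s t : ℕ} {G : D.Ext⟦X⟧[X]}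

lemma paramX_next (hC : ∀ a, S.pull (Polynomial.C a) = Polynomial.C (S.paramX a)) :
    (S.next D s t G).paramX = (D.substX t).comp S.paramX := by
  ext1 a
  change (D.sigma s t (center G) (S.pull (Polynomial.C a))).eval 0 = _
  rw [hC, EdgeData.sigma_C, Polynomial.eval_C, RingHom.comp_apply]

lemma IsFullChain.isChain_next (h : S.IsFullChain d e μ v lam) (hP : D.P.Monic) (hm : 0 < D.m)
    (hst : D.q * s = t * D.m + 1) (hz : D.z ≠ 0)
    (hc0 : PowerSeries.constantCoeff (center G) = 0) :
    (S.next D s t G).IsChain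
      (Fin.snoc (α := fun _ => ℕ) d (D.q * D.P.natDegree * d (Fin.last S.k)))
      (D.q * e) (AdjoinRoot.of D.P μ * D.z ^ (t * e))
      (fun j => D.q * v j + D.m * if j = Fin.last S.k then 1 else 0)
      (fun j => AdjoinRoot.of D.P (lam j) *
        D.z ^ (t * v j + s * if j = Fin.last S.k then 1 else 0)) where
  d_zero := by
    have h0 : (0 : Fin (S.k + 1 + 1)) = Fin.castSucc 0 := rfl
    change Fin.snoc (α := fun _ => ℕ) d _ 0 = 1
    rw [h0, Fin.snoc_castSucc, h.chain.d_zero]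
  d_succ i := by
    change Fin.snoc (α := fun _ => ℕ) d _ i.succ = Fin.snoc (α := fun _ => ℕ) S.bound _ i *
      Fin.snoc (α := fun _ => ℕ) d _ (Fin.castSucc i)
    refine Fin.lastCases ?_ (fun i => ?_) i
    · rw [Fin.succ_last, Fin.snoc_last, Fin.snoc_last, Fin.snoc_castSucc]
    · rw [Fin.succ_castSucc, Fin.snoc_castSucc, Fin.snoc_castSucc, Fin.snoc_castSucc,
        h.chain.d_succ]
  bound_pos i := by
    change 0 < Fin.snoc (α := fun _ => ℕ) S.bound _ i
    refine Fin.lastCases ?_ (fun i => ?_) i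
    · rw [Fin.snoc_last]
      exact Nat.mul_pos (Nat.pos_of_ne_zero D.q_ne_zero) D.irreducible.natDegree_pos
    · rw [Fin.snoc_castSucc]
      exact h.chain.bound_pos i
  phi_monic := h.psi_monic
  phi_natDegree j := by
    rw [Fin.snoc_castSucc]
    exact h.psi_natDegree j
  pull_C a := by
    rw [paramX_next h.chain.pull_C]
    change D.sigma s t (center G) (S.pull (Polynomial.C a)) = _
    rw [h.chain.pull_C, EdgeData.sigma_C, RingHom.comp_apply]
  origin_pull_C a := by
    change origin D.Ext (D.sigma s t (center G) (S.pull (Polynomial.C a))) =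
      algebraMap K D.Ext _
    rw [EdgeData.origin_sigma D hm, h.chain.origin_pull_C, AdjoinRoot.algebraMap_eq',
      RingHom.comp_apply]
  spanned := by
    rw [paramX_next h.chain.pull_C, Fin.snoc_last, mul_comm]
    exact (EdgeData.spannedBy_substX hP hz t).comp h.chain.spanned
  e_pos := Nat.mul_pos (Nat.pos_of_ne_zero D.q_ne_zero) h.chain.e_pos
  mu_ne_zero := mul_ne_zero
    ((map_ne_zero_iff _ (AdjoinRoot.of D.P).injective).2 h.chain.mu_ne_zero) (pow_ne_zero _ hz)
  lead_X := by
    have := D.hasLead_sigma hm s t hc0 h.chain.lead_X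
    simp only [mul_zero, add_zero] at this
    exact this
  lead_phi j := D.hasLead_sigma hm s t hc0 (h.lead_psi j)
  lam_ne_zero j := mul_ne_zero
    ((map_ne_zero_iff _ (AdjoinRoot.of D.P).injective).2 (h.lam_ne_zero j)) (pow_ne_zero _ hz)
  indep := by
    have h1 := IndepOn.sigma (K := K) (D := D) hst hz
      (E := {b : Fin (S.k + 1) → ℕ | ∀ i : Fin S.k, b i.castSucc < S.bound i})
      (h.chain.indep.of_last (h.lam_ne_zero (Fin.last S.k)))
    intro w T f hT
    refine h1 w T f fun B hB => ⟨⟨fun i => ?_, ?_⟩, (hT B hB).2⟩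
    · have := (hT B hB).1 i.castSucc
      change _ < Fin.snoc (α := fun _ => ℕ) S.bound _ i.castSucc at this
      rwa [Fin.snoc_castSucc] at this
    · have := (hT B hB).1 (Fin.last S.k)
      change _ < Fin.snoc (α := fun _ => ℕ) S.bound _ (Fin.last S.k) at this
      rwa [Fin.snoc_last] at this

lemma IsFullChain.next (h : S.IsFullChain d e μ v lam) (hP : D.P.Monic) (hm : 0 < D.m)
    (hst : D.q * s = t * D.m + 1) (hz : D.z ≠ 0) (hq : (D.q : S.L) ≠ 0)
    (hl : (D.P.natDegree : S.L) ≠ 0)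
    (hc0 : PowerSeries.constantCoeff (center G) = 0) :
    ∃ e μ v lam, (S.next D s t G).IsFullChain
      (Fin.snoc (α := fun _ => ℕ) d (D.q * D.P.natDegree * d (Fin.last S.k))) e μ v lam := by
  have hch := h.isChain_next (G := G) hP hm hst hz hc0
  obtain ⟨hmonic, hdeg, heval⟩ := hch.minPoly_spec
  obtain ⟨a, α, hα, hlead⟩ := h.exists_lead_sigma hm hst hz hq hl hc0
    hmonic.ne_zero (by rw [hdeg, Fin.snoc_last]) heval
  exact ⟨_, _, _, _, hch.full hα hlead⟩

end Next

lemma natCast_ne_zero_of_le {n d : ℕ} (hchar : ringChar K = 0 ∨ d < ringChar K) (hn : 0 < n)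
    (hnd : n ≤ d) : (n : K) ≠ 0 := by
  rw [Ne, ringChar.spec]
  intro h
  rcases hchar with h0 | h0
  · rw [h0, zero_dvd_iff] at h
    omega
  · have := Nat.le_of_dvd hn h
    omega

/-- The description of the stages attached to a Weierstrass polynomial. -/
theorem Reach.exists_isFullChain {F : K⟦X⟧[X]} (hW : IsWeierstrass F)
    (hchar : ringChar K = 0 ∨ F.natDegree < ringChar K) {S : Stage K} (hS : Reach F S) :
    ∃ d e μ v lam, S.IsFullChain d e μ v lam ∧ IsWeierstrass S.H ∧
      F.natDegree = S.H.natDegree * d (Fin.last S.k) ∧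
      ∃ (a : ℕ) (W : S.L⟦X⟧[X]), origin S.L W ≠ 0 ∧
        S.pull F = Polynomial.C (PowerSeries.X ^ a) * S.H * W := by
  induction hS with
  | init =>
    obtain ⟨v, lam, h⟩ := exists_isFullChain_init F
    refine ⟨_, _, _, v, lam, h, hW.shift hW.constantCoeff_center, ?_, 0, 1, ?_, ?_⟩
    · rw [mul_one]; exact (natDegree_shift _ _).symm
    · rw [map_one]; exact one_ne_zero
    · change shift (center F) F = _
      simp
  | next S D s t G hS hD hst ht hG ih =>
    obtain ⟨d, e, μ, v, lam, h, hH, hdeg, a, W, hW0, hfac⟩ := ih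
    obtain ⟨hGW, hGN, V, hV, hGV⟩ := hG
    have hm := hD.m_pos hH
    have hz := EdgeData.z_ne_zero hD.coeff_zero_ne
    have hHdeg := hD.natDegree_eq hH
    have hN : 0 < D.N := hGN ▸ hGW.degree_pos
    have hdpos := h.chain.d_last_pos
    have hqpos := Nat.pos_of_ne_zero D.q_ne_zero
    have hlpos := D.irreducible.natDegree_pos
    -- Both `q` and `deg P` divide `deg F`, so the assumption on the characteristic makes them
    -- non-zero in the field.
    have hFdeg : F.natDegree = D.q * (D.N * D.P.natDegree * d (Fin.last S.k)) := by
      rw [hdeg, hHdeg]; ring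
    have hFdeg' : F.natDegree = D.P.natDegree * (D.N * D.q * d (Fin.last S.k)) := by
      rw [hdeg, hHdeg]; ring
    have hq : (D.q : S.L) ≠ 0 := by
      rw [← map_natCast (algebraMap K S.L)]
      refine (map_ne_zero_iff _ (algebraMap K S.L).injective).2
        (natCast_ne_zero_of_le hchar hqpos ?_)
      rw [hFdeg]
      exact Nat.le_mul_of_pos_right _ (by positivity)
    have hl : (D.P.natDegree : S.L) ≠ 0 := by
      rw [← map_natCast (algebraMap K S.L)]
      refine (map_ne_zero_iff _ (algebraMap K S.L).injective).2
        (natCast_ne_zero_of_le hchar hlpos ?_)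
      rw [hFdeg']
      exact Nat.le_mul_of_pos_right _ (by positivity)
    have hc0 := hGW.constantCoeff_center
    obtain ⟨e', μ', v', lam', h'⟩ := h.next (G := G) hD.monic hm hst hz hq hl hc0
    -- The unit is a polynomial in `y`, so the substitution of `y + c_k` applies to it.
    obtain ⟨U, hUV, hU⟩ := hGW.exists_polynomial hGV
    have hU0 : origin D.Ext U ≠ 0 := by
      have h1 := (hV.map (PowerSeries.constantCoeff (R := D.Ext⟦X⟧))).map
        (PowerSeries.constantCoeff (R := D.Ext))
      have h2 : PowerSeries.constantCoeff (U : D.Ext⟦X⟧⟦X⟧) = U.coeff 0 := by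
        rw [← PowerSeries.coeff_zero_eq_constantCoeff_apply, Polynomial.coeff_coe]
      rw [← hUV, h2] at h1
      rw [origin_apply]
      exact h1.ne_zero
    -- The constant `z^(t a)` comes from the pull-back of the old factor `x^a`.
    refine ⟨_, e', μ', v', lam', h', hGW.shift hc0, ?_,
      D.q * a + D.q * D.m * D.P.natDegree * D.N, Polynomial.C (PowerSeries.C (D.z ^ (t * a))) *
        shift (center G) U * D.sigma s t (center G) W, ?_, ?_⟩
    · change F.natDegree = (shift (center G) G).natDegree *
        Fin.snoc (α := fun _ => ℕ) d _ (Fin.last (S.k + 1))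
      rw [natDegree_shift, hGN, Fin.snoc_last, hFdeg]
      ring
    · rw [map_mul, map_mul, origin_C, PowerSeries.constantCoeff_C, origin_shift _ hc0,
        EdgeData.origin_sigma D hm]
      exact mul_ne_zero (mul_ne_zero (pow_ne_zero _ hz) hU0)
        ((map_ne_zero_iff _ (AdjoinRoot.of D.P).injective).2 hW0)
    · change D.sigma s t (center G) (S.pull F) = _
      rw [hfac, map_mul, map_mul, D.sigma_eq_shift s t _ S.H, hU, EdgeData.sigma_C, map_mul,
        map_mul, shift_C, map_pow (D.substX t), EdgeData.substX_X, mul_pow, ← map_pow,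
        ← pow_mul, ← pow_mul, pow_add, Polynomial.C_mul, Polynomial.C_mul]
      ring

end Stage

/-- Modulo `x`, the product `H W` is a power of `y` times a polynomial with non-zero constant term.
-/
lemma xVal_mul_eq {L : Type u} [Field L] {H W : L⟦X⟧[X]} (hH : IsWeierstrass H)
    (hW : origin L W ≠ 0) (a : ℕ) :
    xVal (Polynomial.C (PowerSeries.X ^ a) * H * W) = a := by
  apply le_antisymm
  · refine (iInf_le _ H.natDegree).trans (PowerSeries.order_le _ ?_)
    rw [mul_assoc, Polynomial.coeff_C_mul, PowerSeries.coeff_X_pow_mul', if_pos le_rfl,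
      Nat.sub_self, PowerSeries.coeff_zero_eq_constantCoeff_apply, ← residue_coeff, map_mul,
      ((isWeierstrass_iff H).1 hH).2.2]
    have := Polynomial.coeff_X_pow_mul (residue L W) H.natDegree 0
    rw [zero_add] at this
    rwa [this, ← origin_eq]
  · refine le_iInf fun i => PowerSeries.nat_le_order _ _ fun n hn => ?_
    rw [mul_assoc, Polynomial.coeff_C_mul, PowerSeries.coeff_X_pow_mul', if_neg (not_le.2 hn)]

/-! ### Translation into `V`, `Λ` and `Φ`-adic expansions. -/

namespace Stage

namespace IsFullChain

variable {K : Type u} [Field K] {S : Stage K} {d : Fin (S.k + 1) → ℕ} {e : ℕ} {μ : S.L}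
  {v : Fin (S.k + 1) → ℕ} {lam : Fin (S.k + 1) → S.L} (h : S.IsFullChain d e μ v lam)
include h

lemma V_zero : S.V 0 = e := h.chain.lead_X.xVal_eq h.chain.mu_ne_zero

lemma V_succ (j : Fin (S.k + 1)) : S.V j.succ = v j := (h.lead_psi j).xVal_eq (h.lam_ne_zero j)

lemma Lam_zero : S.Lam 0 = μ := h.chain.lead_X.xTrailing_eq h.chain.mu_ne_zero

lemma Lam_succ (j : Fin (S.k + 1)) : S.Lam j.succ = lam j :=
  (h.lead_psi j).xTrailing_eq (h.lam_ne_zero j)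

lemma Lam_ne_zero (j : Fin (S.k + 2)) : S.Lam j ≠ 0 := by
  refine Fin.cases ?_ (fun j => ?_) j
  · rw [h.Lam_zero]; exact h.chain.mu_ne_zero
  · rw [h.Lam_succ]; exact h.lam_ne_zero j

lemma pairing_eq (B : Fin (S.k + 2) → ℕ) :
    S.pairing B = (weight e v (B 0, fun j => B j.succ) : ℕ) := by
  rw [pairing, Fin.sum_univ_succ, h.V_zero]
  simp only [h.V_succ, weight]
  push_cast
  rfl

lemma prod_Lam (B : Fin (S.k + 2) → ℕ) :
    ∏ j, S.Lam j ^ B j = leadMonomial μ lam (B 0, fun j => B j.succ) := by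
  rw [Fin.prod_univ_succ, h.Lam_zero]
  simp only [h.Lam_succ, leadMonomial]

lemma prod_Lam_B0 : ∏ j, S.Lam j ^ S.B0 j = lam (Fin.last S.k) ^ S.H.natDegree := by
  rw [Finset.prod_eq_single (Fin.last (S.k + 1))]
  · rw [B0, Pi.single_eq_same, ← Fin.succ_last, h.Lam_succ]
  · intro j _ hj
    rw [B0, Pi.single_eq_of_ne hj, pow_zero]
  · intro hn; exact absurd (Finset.mem_univ _) hn

lemma prod_Lam_sub (B : Fin (S.k + 2) → ℕ) :
    ∏ j, S.Lam j ^ ((B j : ℤ) - (S.B0 j : ℤ)) =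
      leadMonomial μ lam (B 0, fun j => B j.succ) / lam (Fin.last S.k) ^ S.H.natDegree := by
  rw [← h.prod_Lam, ← h.prod_Lam_B0, ← Finset.prod_div_distrib]
  refine Finset.prod_congr rfl fun j _ => ?_
  rw [zpow_sub₀ (h.Lam_ne_zero j), zpow_natCast, zpow_natCast]

/-- As `e > 0`, the weight bounds the exponent of `x`; the other exponents are bounded by `𝓑` or
equal to `i`. -/
lemma finite_expSetAt (i : ℕ) (w : ℕ∞) : (S.expSetAt i w).Finite := by
  rcases eq_or_ne w ⊤ with rfl | hw
  · convert Set.finite_empty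
    rw [Set.eq_empty_iff_forall_notMem]
    rintro B ⟨-, -, hB⟩
    rw [h.pairing_eq] at hB
    exact ENat.natCast_ne_top _ hB
  · lift w to ℕ using hw
    refine (Set.finite_Iic (Fin.cons w (Fin.snoc (α := fun _ => ℕ) S.bound i) :
      Fin (S.k + 2) → ℕ)).subset ?_
    rintro B ⟨hB, hl, hw⟩
    rw [h.pairing_eq, Nat.cast_inj] at hw
    rw [Set.mem_Iic]
    intro j
    refine Fin.cases ?_ (fun j => Fin.lastCases ?_ (fun j => ?_) j) j
    · rw [Fin.cons_zero, ← hw]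
      exact (Nat.le_mul_of_pos_right _ h.chain.e_pos).trans (Nat.le_add_right _ _)
    · rw [Fin.cons_succ, Fin.snoc_last]
      exact hl.le
    · rw [Fin.cons_succ, Fin.snoc_castSucc]
      exact (hB j).le

omit h in
/-- The coefficients of a `Φ`-adic expansion over `K` are those of power series that are the
coefficients of an expansion over `K[[x]]`. -/
lemma isExpansion_iff (F : K⟦X⟧[X]) (f : (Fin (S.k + 2) → ℕ) → K) :
    S.IsExpansion F f ↔ ∃ c : (Fin (S.k + 1) → ℕ) →₀ K⟦X⟧,
      (∀ b ∈ c.support, ∀ i : Fin S.k, b i.castSucc < S.bound i) ∧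
      F = (c.sum fun b a => Polynomial.C a * ∏ j, S.psi j ^ b j) ∧
      ∀ B, f B = PowerSeries.coeff (B 0) (c fun j => B j.succ) := by
  classical
  constructor
  · rintro ⟨hf, T, hT, hF⟩
    have hne : ∀ b : Fin (S.k + 1) → ℕ, (PowerSeries.mk fun n => f (Fin.cons n b)) ≠ 0 →
        ∃ n, f (Fin.cons n b) ≠ 0 := by
      intro b hb
      obtain ⟨n, hn⟩ := PowerSeries.exists_coeff_ne_zero_iff_ne_zero.2 hb
      exact ⟨n, by rwa [PowerSeries.coeff_mk] at hn⟩
    refine ⟨Finsupp.onFinset T (fun b => PowerSeries.mk fun n => f (Fin.cons n b)) fun b hb => ?_,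
      fun b hb i => ?_, ?_, fun B => ?_⟩
    · obtain ⟨n, hn⟩ := hne b hb
      exact hT n b hn
    · obtain ⟨n, hn⟩ := hne b (Finsupp.mem_support_iff.1 hb)
      exact hf _ hn i
    · rw [Finsupp.onFinset_sum _ (by simp)]
      exact hF
    · rw [Finsupp.onFinset_apply, PowerSeries.coeff_mk]
      congr 1
      exact (Fin.cons_self_tail B).symm
  · rintro ⟨c, hc, hF, hf⟩
    have hmem : ∀ B, f B ≠ 0 → (fun j => B j.succ) ∈ c.support := by
      intro B hB
      rw [Finsupp.mem_support_iff]
      intro h0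
      rw [hf, h0, map_zero] at hB
      exact hB rfl
    refine ⟨fun B hB i => hc _ (hmem B hB) i, c.support, fun n b hb => hmem _ hb, ?_⟩
    rw [hF]
    refine Finset.sum_congr rfl fun b _ => ?_
    congr 2
    ext n
    rw [PowerSeries.coeff_mk, hf]
    rfl

lemma existsUnique_expansion (F : K⟦X⟧[X]) : ∃! f, S.IsExpansion F f := by
  obtain ⟨c, hc, hF⟩ := h.exists_expansion F
  refine ⟨fun B => PowerSeries.coeff (B 0) (c fun j => B j.succ),
    (isExpansion_iff F _).2 ⟨c, hc, hF, fun _ => rfl⟩, fun f hf => ?_⟩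
  obtain ⟨c', hc', hF', hf'⟩ := (isExpansion_iff F f).1 hf
  have h0 : c' - c = 0 := by
    classical
    refine eq_zero_of_sum_monic (p := fun b : Fin (S.k + 1) → ℕ => ∏ j, S.psi j ^ b j)
      (monic_prod_pow h.psi_monic) h.injOn_natDegree (fun b hb => ?_) ?_
    · rcases Finset.mem_union.1 (Finsupp.support_sub hb) with h1 | h1
      · exact hc' b h1
      · exact hc b h1
    · rw [Finsupp.sum_sub_index (by intros; rw [Polynomial.C_sub, sub_mul]), ← hF', ← hF, sub_self]
  rw [sub_eq_zero] at h0
  funext B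
  rw [hf', h0]

variable {F : K⟦X⟧[X]} {c : (Fin (S.k + 1) → ℕ) →₀ K⟦X⟧}
  (hc : ∀ b ∈ c.support, ∀ i : Fin S.k, b i.castSucc < S.bound i)
include hc

/-- The leading part of the expansion of a monic polynomial of degree `N deg φ_k`. -/
lemma lastPart_eq_single (hF : F = c.sum fun b a => Polynomial.C a * ∏ j, S.psi j ^ b j)
    (hmonic : F.Monic) {N : ℕ} (hN : F.natDegree = N * d (Fin.last S.k)) :
    lastPart c N = Finsupp.single (Pi.single (Fin.last S.k) N) 1 := by
  classical
  have hdpos : ∀ j, 0 < d j := by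
    intro j
    induction j using Fin.induction with
    | zero => rw [h.chain.d_zero]; exact one_pos
    | succ i ih => rw [h.chain.d_succ]; exact Nat.mul_pos (h.chain.bound_pos i) ih
  have hdeg : ∀ b ∈ c.support, ∑ j, b j * d j ≤ N * d (Fin.last S.k) := fun b hb =>
    h.last_le_of_natDegree_le hc (by rw [← hF, hN]) hb
  have hsum : ∑ j, (Pi.single (Fin.last S.k) N : Fin (S.k + 1) → ℕ) j * d j =
      N * d (Fin.last S.k) := by
    rw [Finset.sum_eq_single (Fin.last S.k)]
    · rw [Pi.single_eq_same]
    · intro j _ hj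
      rw [Pi.single_eq_of_ne hj, zero_mul]
    · intro hn; exact absurd (Finset.mem_univ _) hn
  have hone : c (Pi.single (Fin.last S.k) N) = 1 := by
    have h1 := coeff_sum_monic (p := fun b : Fin (S.k + 1) → ℕ => ∏ j, S.psi j ^ b j)
      (monic_prod_pow h.psi_monic) h.injOn_natDegree hc (b := Pi.single (Fin.last S.k) N)
      (fun i => by
        rw [Pi.single_eq_of_ne (Fin.castSucc_lt_last i).ne]
        exact h.chain.bound_pos i)
      (fun b hb => by
        simp only [h.natDegree_prod]
        rw [hsum]
        exact hdeg b hb)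
    rw [← h1, ← hF, h.natDegree_prod, hsum, ← hN, hmonic.coeff_natDegree]
  ext1 b
  by_cases hb : b = Pi.single (Fin.last S.k) N
  · rw [hb, Finsupp.single_eq_same, lastPart_apply (Pi.single_eq_same _ _), hone]
  · rw [Finsupp.single_eq_of_ne hb]
    by_contra hne
    obtain ⟨hbs, hbl⟩ := mem_support_lastPart.1 (Finsupp.mem_support_iff.2 hne)
    apply hb
    have h1 := hdeg b hbs
    rw [Fin.sum_univ_castSucc, hbl] at h1
    -- The factor `φ_k^N` alone already has the degree of `F`.
    have h2 : ∑ j : Fin S.k, b j.castSucc * d j.castSucc = 0 := by omega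
    rw [Finset.sum_eq_zero_iff] at h2
    funext j
    refine Fin.lastCases ?_ (fun j => ?_) j
    · rw [hbl, Pi.single_eq_same]
    · rw [Pi.single_eq_of_ne (Fin.castSucc_lt_last j).ne]
      exact (Nat.mul_eq_zero.1 (h2 j (Finset.mem_univ _))).resolve_right (hdpos _).ne'

variable {f : (Fin (S.k + 2) → ℕ) → K}
  (hf : ∀ B, f B = PowerSeries.coeff (B 0) (c fun j => B j.succ))
include hf

omit h hc in
lemma minVal_eq_top {i : ℕ} (hi : i ∉ lastEntries c) : S.minVal f i = ⊤ := by
  simp only [minVal, iInf_eq_top]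
  rintro B ⟨hB, hne⟩
  refine absurd (Finset.mem_image.2 ⟨fun j => B j.succ, ?_, hB⟩) hi
  rw [Finsupp.mem_support_iff]
  intro h0
  rw [hf, h0, map_zero] at hne
  exact hne rfl

omit hc in
lemma minVal_eq {i w : ℕ}
    (hw : ∀ n b, PowerSeries.coeff n (lastPart c i b) ≠ 0 → w ≤ weight e v (n, b))
    (hex : ∃ n b, PowerSeries.coeff n (lastPart c i b) ≠ 0 ∧ weight e v (n, b) = w) :
    S.minVal f i = w := by
  apply le_antisymm
  · obtain ⟨n, b, hne, hwt⟩ := hex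
    have hbl : b (Fin.last S.k) = i := by
      refine (mem_support_lastPart (c := c).1 (Finsupp.mem_support_iff.2 ?_)).2
      rintro h0
      rw [h0, map_zero] at hne
      exact hne rfl
    have h1 : (Fin.cons n b : Fin (S.k + 2) → ℕ) (Fin.last _) = i := by
      rw [← Fin.succ_last, Fin.cons_succ, hbl]
    have h2 : f (Fin.cons n b) ≠ 0 := by
      rw [hf]
      rw [lastPart_apply hbl] at hne
      exact hne
    refine (iInf₂_le (Fin.cons n b : Fin (S.k + 2) → ℕ) ⟨h1, h2⟩).trans ?_
    rw [h.pairing_eq, ← hwt]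
    rfl
  · refine le_iInf₂ fun B hB => ?_
    rw [h.pairing_eq, Nat.cast_le]
    apply hw
    have h1 : lastPart c i (fun j : Fin (S.k + 1) => B j.succ) = c fun j => B j.succ :=
      lastPart_apply hB.1
    rw [h1, ← hf]
    exact hB.2

/-- The coefficients of the formula for the boundary polynomial. -/
lemma finsum_eq_leadSum (i w : ℕ) :
    ∑ᶠ B ∈ S.expSetAt i w, algebraMap K S.L (f B) * ∏ j, S.Lam j ^ ((B j : ℤ) - (S.B0 j : ℤ)) =
      leadSum e μ v lam (lastPart c i) w / lam (Fin.last S.k) ^ S.H.natDegree := by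
  classical
  let φ : ℕ × (Fin (S.k + 1) → ℕ) → Fin (S.k + 2) → ℕ := fun p => Fin.cons p.1 p.2
  have hφ : Function.Injective φ := fun p p' hp => by
    have := Fin.cons_inj.1 hp
    exact Prod.ext this.1 this.2
  have hmem : ∀ p ∈ exponents e v (lastPart c i) w, p.2 ∈ c.support ∧
      p.2 (Fin.last S.k) = i ∧ weight e v p = w := by
    intro p hp
    rw [exponents, Finset.mem_filter, Finset.mem_product, mem_support_lastPart] at hp
    exact ⟨hp.1.2.1, hp.1.2.2, hp.2⟩
  rw [finsum_mem_eq_sum_of_inter_support_eq (t := (exponents e v (lastPart c i) w).image φ),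
    Finset.sum_image hφ.injOn, leadSum, Finset.sum_div]
  · refine Finset.sum_congr rfl fun p hp => ?_
    rw [h.prod_Lam_sub, hf, lastPart_apply (hmem p hp).2.1, mul_div_assoc]
    rfl
  · ext B
    simp only [Set.mem_inter_iff, and_congr_left_iff, Function.mem_support, Finset.coe_image,
      Set.mem_image, Finset.mem_coe]
    intro hne
    constructor
    · rintro ⟨hB, hl, hwt⟩
      rw [h.pairing_eq, Nat.cast_inj] at hwt
      refine ⟨(B 0, fun j => B j.succ), ?_, Fin.cons_self_tail B⟩
      rw [exponents, Finset.mem_filter, Finset.mem_product, mem_support_lastPart, Finset.mem_range,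
        Nat.lt_succ_iff]
      refine ⟨⟨?_, ?_, hl⟩, hwt⟩
      · rw [← hwt]
        exact (Nat.le_mul_of_pos_right _ h.chain.e_pos).trans (Nat.le_add_right _ _)
      · rw [Finsupp.mem_support_iff]
        intro h0
        rw [hf, h0, map_zero, map_zero, zero_mul] at hne
        exact hne rfl
    · rintro ⟨p, hp, rfl⟩
      obtain ⟨h1, h2, h3⟩ := hmem p hp
      refine ⟨fun j => hc _ h1 j, h2, ?_⟩
      rw [h.pairing_eq, ← h3]
      rfl

end IsFullChain

end Stage

end NewtonPuiseux

end

/-! ### The formula for the boundary polynomial. -/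

theorem mainTheorem4 {K : Type u} [Field K] [PerfectField K] (F : K⟦X⟧[X])
    (hW : NewtonPuiseux.IsWeierstrass F) (hsq : Squarefree F)
    (hchar : ringChar K = 0 ∨ F.natDegree < ringChar K)
    (S : NewtonPuiseux.Stage K) (hS : NewtonPuiseux.Stage.Reach F S) :
    -- the `Φ`-adic expansion exists and is unique, and the quantities in the formula make sense
    (∃! f : (Fin (S.k + 2) → ℕ) → K, S.IsExpansion F f) ∧
    S.val F ≠ ⊤ ∧
    (∀ j, S.Lam j ≠ 0) ∧
    (∀ i w, (S.expSetAt i w).Finite) ∧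
    ∀ f : (Fin (S.k + 2) → ℕ) → K, S.IsExpansion F f →
      (∀ i, S.w F f i + S.val F = S.minVal f i) ∧
      -- the formula for the boundary polynomial
      NewtonPuiseux.boundaryPoly S.H =
        ∑ i ∈ S.edgeIndices F f, Polynomial.monomial i
          (PowerSeries.monomial (S.w F f i).toNat
            (∑ᶠ B ∈ S.expSetAt i (S.w F f i + S.val F),
              algebraMap K S.L (f B) * ∏ j, S.Lam j ^ ((B j : ℤ) - (S.B0 j : ℤ)))) := by
  classical
  obtain ⟨d, e, μ, v, lam, h, hH, hdeg, a, W, hW0, hfac⟩ := hS.exists_isFullChain hW hchar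
  have hval : S.val F = a := by rw [NewtonPuiseux.Stage.val, hfac, NewtonPuiseux.xVal_mul_eq hH hW0]
  refine ⟨h.existsUnique_expansion F, by rw [hval]; exact ENat.natCast_ne_top a, h.Lam_ne_zero,
    h.finite_expSetAt, fun f hexp => ?_⟩
  obtain ⟨c, hc, hF, hf⟩ := (NewtonPuiseux.Stage.IsFullChain.isExpansion_iff F f).1 hexp
  -- The value `0` at indices that do not occur is arbitrary; there `S.w F f i` is `⊤`.
  have hex : ∀ i, ∃ w : ℕ, i ∈ NewtonPuiseux.lastEntries c → _ := fun i => by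
    by_cases hi : i ∈ NewtonPuiseux.lastEntries c
    · exact (h.exists_lead_lastPart hc hi).imp fun w hw _ => hw
    · exact ⟨0, fun hi' => absurd hi' hi⟩
  choose w hw using hex
  have hsum : Polynomial.C (PowerSeries.X ^ a) * S.H * W = ∑ i ∈ NewtonPuiseux.lastEntries c,
      S.pull ((NewtonPuiseux.lastPart c i).sum
        fun b a => Polynomial.C a * ∏ j, S.psi j ^ b j) := by
    rw [← hfac, hF, NewtonPuiseux.sum_lastPart, map_sum]
  have hle : ∀ i ∈ NewtonPuiseux.lastEntries c, a ≤ w i := fun i hi =>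
    NewtonPuiseux.le_of_eq_sum_lead (fun i hi => (hw i hi).2.2.2) (fun i hi => (hw i hi).2.2.1)
      hsum hi
  have hmin : ∀ i ∈ NewtonPuiseux.lastEntries c, S.minVal f i = w i := fun i hi =>
    h.minVal_eq hf (hw i hi).1 (hw i hi).2.1
  have hwF : ∀ i ∈ NewtonPuiseux.lastEntries c, S.w F f i = ((w i - a : ℕ) : ℕ∞) := fun i hi => by
    rw [NewtonPuiseux.Stage.w, hmin i hi, hval, ENat.natCast_sub]
  have hwtop : ∀ i ∉ NewtonPuiseux.lastEntries c, S.w F f i = ⊤ := fun i hi => by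
    rw [NewtonPuiseux.Stage.w, NewtonPuiseux.Stage.IsFullChain.minVal_eq_top hf hi, hval,
      ENat.top_sub_natCast]
  refine ⟨fun i => ?_, ?_⟩
  · by_cases hi : i ∈ NewtonPuiseux.lastEntries c
    · rw [hwF i hi, hval, hmin i hi, ← Nat.cast_add, Nat.sub_add_cancel (hle i hi)]
    · rw [hwtop i hi, NewtonPuiseux.Stage.IsFullChain.minVal_eq_top hf hi, top_add]
  have hcoeff : ∀ i j : ℕ, ((i : ℝ), (j : ℝ)) ∈ NewtonPuiseux.newtonPolygon S.H → _ := fun i j =>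
    NewtonPuiseux.coeff_eq_of_eq_sum_lead hH (fun i hi => (hw i hi).2.2.2)
      (fun i hi => (hw i hi).2.2.1) hsum (i := i) (j := j)
  have hlamN : lam (Fin.last S.k) ^ S.H.natDegree ≠ 0 := pow_ne_zero _ (h.lam_ne_zero _)
  -- Compare at `(N_k, 0)`, where `H_k` has coefficient `1`: the part of the expansion with `b_k =
  -- N_k` is `φ_k^(N_k)` alone, with coefficient `1`. The alternative, a zero right-hand side,
  -- contradicts `W(0,0) ≠ 0`.
  have horigin : NewtonPuiseux.origin S.L W = lam (Fin.last S.k) ^ S.H.natDegree := by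
    have h1 := hcoeff S.H.natDegree 0 (by simpa using hH.top_mem_newtonPolygon)
    rw [hH.monic.coeff_natDegree, PowerSeries.coeff_zero_one, one_mul] at h1
    split_ifs at h1 with hN
    · rw [h1]
      obtain ⟨-, ⟨n, b, hne, hwt⟩, -⟩ := hw _ hN.1
      rw [h.lastPart_eq_single hc hF hW.monic hdeg] at hne ⊢
      have hb : b = Pi.single (Fin.last S.k) S.H.natDegree := by
        by_contra hb
        rw [Finsupp.single_eq_of_ne hb, map_zero] at hne
        exact hne rfl
      subst hb
      rw [Finsupp.single_eq_same, PowerSeries.coeff_one] at hne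
      have hn : n = 0 := by
        by_contra hn
        rw [if_neg hn] at hne
        exact hne rfl
      subst hn
      rw [NewtonPuiseux.leadSum, Finset.sum_eq_single (0, Pi.single (Fin.last S.k) S.H.natDegree)]
      · rw [Finsupp.single_eq_same, PowerSeries.coeff_zero_one, map_one, one_mul,
          NewtonPuiseux.leadMonomial, pow_zero, one_mul, Finset.prod_eq_single (Fin.last S.k)]
        · simp only [Pi.single_eq_same]
        · intro j _ hj
          simp only [Pi.single_eq_of_ne hj, pow_zero]
        · intro hn; exact absurd (Finset.mem_univ _) hn
      · rintro ⟨m, b⟩ hB hne'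
        rw [NewtonPuiseux.exponents, Finset.mem_filter] at hB
        have hwt' := hB.2.trans hwt.symm
        by_cases hb : b = Pi.single (Fin.last S.k) S.H.natDegree
        · subst hb
          simp only [NewtonPuiseux.weight, zero_mul, zero_add, Nat.add_eq_right, mul_eq_zero,
            h.chain.e_pos.ne', or_false] at hwt'
          subst hwt'
          exact absurd rfl hne'
        · rw [Finsupp.single_eq_of_ne hb, map_zero, map_zero, zero_mul]
      · intro hn
        refine absurd ?_ hn
        rw [NewtonPuiseux.exponents, Finset.mem_filter, Finset.mem_product, Finset.mem_range]
        exact ⟨⟨Nat.succ_pos _, by simp⟩, hwt⟩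
    · exact absurd h1 hW0
  ext i j
  rw [NewtonPuiseux.coeff_boundaryPoly, Polynomial.finsetSum_coeff]
  simp only [Polynomial.coeff_monomial]
  rw [Finset.sum_ite_eq']
  have hedge : ∀ n : ℕ, S.w F f i = n → (i ∈ S.edgeIndices F f ↔
      ((i : ℝ), (n : ℝ)) ∈ NewtonPuiseux.newtonPolygon S.H) := by
    intro n hn
    rw [NewtonPuiseux.Stage.edgeIndices, Finset.mem_filter, Finset.mem_range, Nat.lt_succ_iff]
    constructor
    · rintro ⟨-, m, hm, hmem⟩
      rw [hn, Nat.cast_inj] at hm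
      rwa [hm]
    · intro hmem
      exact ⟨Nat.cast_le.1 (hH.of_mem_hull hmem.1).1, n, hn, hmem⟩
  by_cases hi : i ∈ NewtonPuiseux.lastEntries c
  · have hiff := hedge _ (hwF i hi)
    have hwadd : S.w F f i + S.val F = w i := by
      rw [hwF i hi, hval, ← Nat.cast_add, Nat.sub_add_cancel (hle i hi)]
    rw [hwadd, h.finsum_eq_leadSum hc hf, hwF i hi, ENat.toNat_natCast]
    by_cases hj : w i = a + j
    · have hj' : w i - a = j := by omega
      rw [hj'] at hiff ⊢
      by_cases hmem : ((i : ℝ), (j : ℝ)) ∈ NewtonPuiseux.newtonPolygon S.H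
      · rw [if_pos hmem, if_pos (hiff.2 hmem), PowerSeries.coeff_monomial_same, eq_div_iff hlamN,
          ← horigin, hcoeff i j hmem, if_pos ⟨hi, hj⟩]
      · rw [if_neg hmem, if_neg fun h' => hmem (hiff.1 h'), map_zero]
    · have hj' : j ≠ w i - a := fun h' => hj (by have := hle i hi; omega)
      have hright : PowerSeries.coeff j (if i ∈ S.edgeIndices F f then
          PowerSeries.monomial (w i - a) (NewtonPuiseux.leadSum e μ v lam
            (NewtonPuiseux.lastPart c i) (w i) / lam (Fin.last S.k) ^ S.H.natDegree)
          else 0) = 0 := by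
        split_ifs
        · rw [PowerSeries.coeff_monomial, if_neg hj']
        · rw [map_zero]
      rw [hright]
      -- A lattice point `(i, j)` of the polygon with `j ≠ w_i` carries no term of `H_k`.
      split_ifs with hmem
      · have h1 := hcoeff i j hmem
        rw [if_neg fun h' => hj h'.2, horigin] at h1
        exact (mul_eq_zero.1 h1).resolve_right hlamN
      · rfl
  · have hnot : i ∉ S.edgeIndices F f := by
      rw [NewtonPuiseux.Stage.edgeIndices, Finset.mem_filter]
      rintro ⟨-, n, hn, -⟩
      rw [hwtop i hi] at hn
      exact ENat.top_ne_natCast n hn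
    rw [if_neg hnot, map_zero]
    split_ifs with hmem
    · have h1 := hcoeff i j hmem
      rw [if_neg fun h' => hi h'.1, horigin] at h1
      exact (mul_eq_zero.1 h1).resolve_right hlamN
    · rfl
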